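/- Let $\mathbb{K}$ be an algebraically closed field of characteristic zero and let $G$ be a finite simple graph with edges labelled $e_1,\dots,e_n$. The edges are also used as the variables of the polynomial ring $R=\mathbb{K}[E(G)]=\mathbb{K}[e_1,\dots,e_n]$, and $<_G$ denotes the lexicographic monomial order with $e_1>e_2>\cdots>e_n$. **Toric ideals.** For a graph $H$, the toric ideal $I_H$ is the kernel of the $\mathbb{K}$-algebra map $\mathbb{K}[E(H)]\to\mathbb{K}[V(H)]$ sending each edge $\{u,v\}$ to $x_ux_v$. A nonzero binomial $e^\alpha-e^\beta\in I_H$ is *primitive* if there is no other nonzero binomial $e^\gamma-e^\delta\in I_H$ with $e^\gamma\mid e^\alpha$ and $e^\delta\mid e^\beta$. Let $\mathcal{U}(I_H)$ be the set of primitive binomials of the form $e_{i_1}e_{i_3}\cdots e_{i_{2\ell-1}}-e_{i_2}e_{i_4}\cdots e_{i_{2\ell}}$, where $(e_{i_1},\dots,e_{i_{2\ell}})$ is a closed even walk in $H$. For $S\subseteq E(G)$, let $G\setminus S$ be $G$ with the edges of $S$ removed; $I_{G\setminus S}$ and $\mathcal{U}(I_{G\setminus S})$ are regarded in $R$ (the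 former as the extended ideal). **The ideals $I^G_{E,F}$.** For disjoint $E,F\subseteq\{e_1,\dots,e_n\}$, let $\mathcal{U}(M^G_{E,F})$ be the set of monomials $m$ for which there are monomials $\ell,p$ with $m\ell-p\in\mathcal{U}(I_G)$ such that (i) $\mathrm{in}_{<_G}(m\ell-p)=m\ell$; (ii) $\ell\neq 1$ and $\ell$ involves only variables in $E$; (iii) no $f\in F$ divides $m\ell$ and no $e\in E$ divides $m$. Let $M^G_{E,F}$ be the ideal generated by these monomials, and put $I^G_{E,F}=I_{G\setminus(E\cup F)}+M^G_{E,F}$. **Geometric vertex decompositions.** Let $y$ be a variable. For $0\ne f\in R$ write $f=y^dq+r$, where $q\neq0$ does not involve $y$ and every term of $r$ has $y$-degree less than $d$; then $\mathrm{in}_y(f)=y^dq$. For an ideal $I$, let $\mathrm{in}_y(I)=\langle \mathrm{in}_y(f)\mid f\in I\rangle$. A monomial order $<$ is *$y$-compatible* if $\mathrm{in}_<(f)=\mathrm{in}_<(\mathrm{in}_y(f))$ for all $f\in R$. If $\{g_i\}$ is a finite Gröbner basis of $I$ with respect to a $y$-compatible order and $\mathrm{in}_y(g_i)=y^{d_i}q_i$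 with $q_i$ not involving $y$, then $C_{y,I}=\langle q_i\rangle$ (over all $i$) and $N_{y,I}=\langle q_i\mid d_i=0\rangle$. The variable $y$ *defines a geometric vertex decomposition of $I$* if $\mathrm{in}_y(I)=C_{y,I}\cap(N_{y,I}+\langle y\rangle)$ for some $y$-compatible order and Gröbner basis as above. **Theorem.** Suppose that $\mathrm{in}_{<_G}(I_G)$ is a square-free monomial ideal. Let $k\in\{1,\dots,n\}$ and let $E,F$ be disjoint sets with $E\cup F=E_{k-1}=\{e_1,\dots,e_{k-1}\}$. Then: 1. The set $\mathcal{U}(I_{G\setminus(E\cup F)})\cup\mathcal{U}(M^G_{E,F})$ generates $I^G_{E,F}$ and is a (finite) Gröbner basis of $I^G_{E,F}$ with respect to $<_G$. Furthermore, $\mathrm{in}_{<_G}(I^G_{E,F})$ is a square-free monomial ideal. 2. $I^G_{E,F}$ is a radical ideal. 3. The variable $y=e_k$ defines a geometric vertex decomposition of $I^G_{E,F}$. 4. If $I=I^G_{E,F}$ and $y=e_k$, then $C_{y,I}=I^G_{E\cup\{e_k\},F}$ and $N_{y,I}=I^G_{E,F\cup\{e_k\}}$, for every $y$-compatible monomial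 order and every Gröbner basis used to compute them. In particular, $$\mathrm{in}_{e_k}(I^G_{E,F})=I^G_{E\cup\{e_k\},F}\cap\bigl(I^G_{E,F\cup\{e_k\}}+\langle e_k\rangle\bigr).$$ -/

import Mathlib

open MvPolynomial

noncomputable section

/-! ### Initial ideals and Groebner bases -/

/-- The initial ideal of `I` with respect to the monomial order `m`. -/
def initialIdeal {σ K : Type*} [Field K] (m : MonomialOrder σ)
    (I : Ideal (MvPolynomial σ K)) : Ideal (MvPolynomial σ K) :=
  Ideal.span (m.leadingTerm '' (I : Set (MvPolynomial σ K)))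

/-- `B` is a (finite) Groebner basis of `I` with respect to `m`. -/
def IsGroebnerBasisOf {σ K : Type*} [Field K] (m : MonomialOrder σ)
    (B : Set (MvPolynomial σ K)) (I : Ideal (MvPolynomial σ K)) : Prop :=
  B.Finite ∧ B ⊆ (I : Set (MvPolynomial σ K)) ∧
    Ideal.span (m.leadingTerm '' B) = initialIdeal m I

/-- `I` is generated by square-free monomials. -/
def IsSquarefreeMonomialIdeal {σ K : Type*} [Field K]
    (I : Ideal (MvPolynomial σ K)) : Prop :=
  ∃ A : Set (σ →₀ ℕ), (∀ a ∈ A, ∀ i, a i ≤ 1) ∧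
    I = Ideal.span ((fun a => monomial a (1 : K)) '' A)

/-! ### Geometric vertex decompositions -/

/-- The initial `y`-form of `f`: the sum of the terms of `f` in which the exponent of `y`
is the largest one, `f.degreeOf y`. -/
def initialForm {σ K : Type*} [Field K] (y : σ) (f : MvPolynomial σ K) : MvPolynomial σ K :=
  open Classical in
  ∑ a ∈ f.support.filter (fun a => a y = f.degreeOf y), monomial a (f.coeff a)

/-- The polynomial `q`, not involving `y`, with `in_y(f) = y ^ d * q` and `d = f.degreeOf y`. -/
def initialFormCoeff {σ K : Type*} [Field K] (y : σ) (f : MvPolynomial σ K) :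
    MvPolynomial σ K :=
  open Classical in
  ∑ a ∈ f.support.filter (fun a => a y = f.degreeOf y), monomial (a.erase y) (f.coeff a)

/-- The ideal `in_y(I)` generated by the initial `y`-forms of the elements of `I`. -/
def initialFormIdeal {σ K : Type*} [Field K] (y : σ) (I : Ideal (MvPolynomial σ K)) :
    Ideal (MvPolynomial σ K) :=
  Ideal.span (initialForm y '' (I : Set (MvPolynomial σ K)))

/-- The monomial order `m` on `K[σ]` is `y`-compatible. -/
def IsCompatibleOrder {σ : Type*} (K : Type*) [Field K] (m : MonomialOrder σ) (y : σ) : Prop :=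
  ∀ f : MvPolynomial σ K, m.leadingTerm f = m.leadingTerm (initialForm y f)

/-- The ideal `C_{y,I} = ⟨q_1, …, q_m⟩` computed from `B = {y ^ d_i * q_i + r_i}`. -/
def idealC {σ K : Type*} [Field K] (y : σ) (B : Set (MvPolynomial σ K)) :
    Ideal (MvPolynomial σ K) :=
  Ideal.span (initialFormCoeff y '' B)

/-- The ideal `N_{y,I} = ⟨q_i ∣ d_i = 0⟩` computed from `B = {y ^ d_i * q_i + r_i}`. -/
def idealN {σ K : Type*} [Field K] (y : σ) (B : Set (MvPolynomial σ K)) :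
    Ideal (MvPolynomial σ K) :=
  Ideal.span (initialFormCoeff y '' {g ∈ B | g.degreeOf y = 0})

/-- `I` has a geometric vertex decomposition with respect to `y`. -/
def HasGeometricVertexDecomposition.{u, v} {σ : Type u} {K : Type v} [Field K] (y : σ)
    (I : Ideal (MvPolynomial σ K)) : Prop :=
  ∃ (m : MonomialOrder.{u, u} σ) (B : Set (MvPolynomial σ K)),
    IsCompatibleOrder K m y ∧ IsGroebnerBasisOf m B I ∧
      initialFormIdeal y I = idealC y B ⊓ (idealN y B ⊔ Ideal.span {X y})

/-! ### Toric ideals of graphs whose edges are labelled by an index type `ι` -/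

/-- The homomorphism `K[E(H)] → K[V(H)]` sending the edge `{u, v}` to `x_u * x_v`. -/
def edgeMap (K : Type*) [Field K] {V ι : Type*} (H : SimpleGraph V) (e : ι ≃ H.edgeSet) :
    MvPolynomial ι K →ₐ[K] MvPolynomial V K :=
  aeval fun i => Sym2.lift ⟨fun u v : V => (X u * X v : MvPolynomial V K),
    fun u v => mul_comm (X u) (X v)⟩ (e i : Sym2 V)

/-- The toric ideal of `H`. -/
def toricIdeal (K : Type*) [Field K] {V ι : Type*} (H : SimpleGraph V) (e : ι ≃ H.edgeSet) :
    Ideal (MvPolynomial ι K) :=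
  RingHom.ker (edgeMap K H e)

/-- The exponents of the products of the edges in odd position and of the edges in even
position (counted from 1) of a list of edges. -/
def alternatingExponents {ι : Type*} : List ι → (ι →₀ ℕ) × (ι →₀ ℕ)
  | [] => (0, 0)
  | i :: L => (Finsupp.single i 1 + (alternatingExponents L).2, (alternatingExponents L).1)

/-- `(a, b)` is the pair of exponents of the binomial
`e_{i_1} e_{i_3} ⋯ e_{i_{2l-1}} - e_{i_2} e_{i_4} ⋯ e_{i_{2l}}` of a closed even walk of `H`. -/
def IsClosedEvenWalkPair {V ι : Type*} (H : SimpleGraph V) (e : ι ≃ H.edgeSet)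
    (a b : ι →₀ ℕ) : Prop :=
  ∃ (v : V) (w : H.Walk v v) (L : List ι), Even w.length ∧
    w.edges = L.map (fun i => (e i : Sym2 V)) ∧ alternatingExponents L = (a, b)

/-- The binomial `e^a - e^b` is a primitive (nonzero) binomial of the toric ideal of `H`. -/
def IsPrimitivePair (K : Type*) [Field K] {V ι : Type*} (H : SimpleGraph V)
    (e : ι ≃ H.edgeSet) (a b : ι →₀ ℕ) : Prop :=
  a ≠ b ∧ monomial a (1 : K) - monomial b 1 ∈ toricIdeal K H e ∧
    ∀ c d : ι →₀ ℕ, c ≠ d → monomial c (1 : K) - monomial d 1 ∈ toricIdeal K H e →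
      c ≤ a → d ≤ b → c = a ∧ d = b

/-- `𝒰(I_H)`: the primitive binomials that correspond to closed even walks of `H`. -/
def primitiveWalkBinomials (K : Type*) [Field K] {V ι : Type*} (H : SimpleGraph V)
    (e : ι ≃ H.edgeSet) : Set (MvPolynomial ι K) :=
  {p | ∃ a b : ι →₀ ℕ, p = monomial a 1 - monomial b 1 ∧
    IsPrimitivePair K H e a b ∧ IsClosedEvenWalkPair H e a b}

/-! ### Deleting edges -/

/-- The graph `G \ S`: the edges with labels in `S` are removed, all vertices are kept. -/
def deleteLabels {V ι : Type*} (G : SimpleGraph V) (e : ι ≃ G.edgeSet) (S : Set ι) :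
    SimpleGraph V :=
  G.deleteEdges ((fun i => (e i : Sym2 V)) '' S)

/-- The labelling of the edges of `G \ S` inherited from `G`. -/
def deleteLabelling {V ι : Type*} (G : SimpleGraph V) (e : ι ≃ G.edgeSet) (S : Set ι) :
    {i // i ∉ S} ≃ (deleteLabels G e S).edgeSet :=
  Equiv.ofBijective
    (fun i => ⟨(e i.1 : Sym2 V), by
      rw [deleteLabels, SimpleGraph.edgeSet_deleteEdges]
      refine ⟨(e i.1).2, ?_⟩
      rintro ⟨j, hj, h⟩
      exact i.2 ((e.injective (Subtype.ext h)) ▸ hj)⟩)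
    (by
      constructor
      · intro i j h
        have h' : (e i.1 : Sym2 V) = (e j.1 : Sym2 V) := congrArg (fun x => x.1) h
        exact Subtype.ext (e.injective (Subtype.ext h'))
      · rintro ⟨x, hx⟩
        have hx' := hx
        rw [deleteLabels, SimpleGraph.edgeSet_deleteEdges] at hx'
        refine ⟨⟨e.symm ⟨x, hx'.1⟩, fun h => hx'.2 ⟨_, h, by simp⟩⟩, ?_⟩
        apply Subtype.ext
        simp)

/-- The toric ideal `I_{G \ S}`, as an ideal of `K[E(G)]`. -/
def toricIdealDelete (K : Type*) [Field K] {V ι : Type*} (G : SimpleGraph V)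
    (e : ι ≃ G.edgeSet) (S : Set ι) : Ideal (MvPolynomial ι K) :=
  Ideal.map (rename (Subtype.val : {i // i ∉ S} → ι))
    (toricIdeal K (deleteLabels G e S) (deleteLabelling G e S))

/-- `𝒰(I_{G \ S})`, as a subset of `K[E(G)]`. -/
def primitiveWalkBinomialsDelete (K : Type*) [Field K] {V ι : Type*} (G : SimpleGraph V)
    (e : ι ≃ G.edgeSet) (S : Set ι) : Set (MvPolynomial ι K) :=
  rename (Subtype.val : {i // i ∉ S} → ι) ''
    primitiveWalkBinomials K (deleteLabels G e S) (deleteLabelling G e S)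

/-! ### The ideals `I^G_{E,F}` -/

/-- `𝒰(M^G_{E,F})`: the monomials `m = e^a` for which there are monomials `ℓ = e^l`, `p = e^b`
with `mℓ - p ∈ 𝒰(I_G)`, with lead term `mℓ` for the lexicographic order `e_1 > e_2 > ⋯`, with
`ℓ ≠ 1` involving only variables of `E`, no variable of `F` dividing `mℓ`, and no variable of
`E` dividing `m`. -/
def monomialGenerators (K : Type*) [Field K] {V : Type*} {n : ℕ} (G : SimpleGraph V)
    (e : Fin n ≃ G.edgeSet) (E F : Set (Fin n)) : Set (MvPolynomial (Fin n) K) :=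
  {q | ∃ a l b : Fin n →₀ ℕ, q = monomial a 1 ∧
    monomial (a + l) (1 : K) - monomial b 1 ∈ primitiveWalkBinomials K G e ∧
    MonomialOrder.lex.leadingTerm (monomial (a + l) (1 : K) - monomial b 1) =
      monomial (a + l) 1 ∧
    l ≠ 0 ∧ (l.support : Set (Fin n)) ⊆ E ∧
    (∀ i ∈ F, (a + l) i = 0) ∧ ∀ i ∈ E, a i = 0}

/-- `I^G_{E,F} = I_{G \ (E ∪ F)} + M^G_{E,F}`. -/
def idealEF (K : Type*) [Field K] {V : Type*} {n : ℕ} (G : SimpleGraph V)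
    (e : Fin n ≃ G.edgeSet) (E F : Set (Fin n)) : Ideal (MvPolynomial (Fin n) K) :=
  toricIdealDelete K G e (E ∪ F) ⊔ Ideal.span (monomialGenerators K G e E F)

/-- The natural generators `𝒰(I_{G \ (E ∪ F)}) ∪ 𝒰(M^G_{E,F})` of `I^G_{E,F}`. -/
def naturalGenerators (K : Type*) [Field K] {V : Type*} {n : ℕ} (G : SimpleGraph V)
    (e : Fin n ≃ G.edgeSet) (E F : Set (Fin n)) : Set (MvPolynomial (Fin n) K) :=
  primitiveWalkBinomialsDelete K G e (E ∪ F) ∪ monomialGenerators K G e E F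

end

/-! Induction on the number of treated labels proves the Groebner and square-free claims together.
Base case: the primitive binomials of a toric ideal form a Groebner basis for every monomial order
(`leadsIdeal_minimalPairs`), and each comes from a closed even walk
(`IsMinimalPair.isClosedEvenWalkPair`).

For the step let `y` be the variable `k`. The order `lexFirst k` is `y`-compatible and agrees with
lex on monomials free of the variables before `k`. The natural generators are free of those
variables, so the Groebner property and square-freeness pass between the two orders
(`LeadsIdeal.of_agreeOff`, `HasSquarefreeLeads.of_agreeOff`). For a compatible order the
coefficients `q_i` form a Groebner basis of `C`, the `y`-free generators form one of `N`, and
square-free leads are inherited. Up to sign, the `q_i` are exactly the natural generators for `(E ∪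
{k}, F)`, and the `y`-free generators are those for `(E, F ∪ {k})`. Hence `C` and `N` are the next
two ideals.

The decomposition follows from radicality: `in_y(I)` has the same leading exponents as `I`, so it is
radical, and an element `y * g` of `C` has a power in `in_y(I)`. Finally `C` is `in_y(I)`
specialised at `y = 1`, and `N` is generated by the `y`-free elements of `I`; so neither depends on
the order or the basis. -/

noncomputable section

open scoped MonomialOrder

/-! ### Groebner bases and square-free initial ideals through divisibility of leading exponents. -/

section Groebner

variable {σ K : Type*} [Field K]

/-- The divisibility form of the Groebner basis property. -/
def LeadsIdeal (m : MonomialOrder σ) (B : Set (MvPolynomial σ K))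
    (I : Ideal (MvPolynomial σ K)) : Prop :=
  B ⊆ (I : Set (MvPolynomial σ K)) ∧
    ∀ f ∈ I, f ≠ 0 → ∃ b ∈ B, b ≠ 0 ∧ m.degree b ≤ m.degree f

theorem degree_eq_of_forall_le {m : MonomialOrder σ} {f : MvPolynomial σ K} {a : σ →₀ ℕ}
    (ha : f.coeff a ≠ 0) (h : ∀ b, f.coeff b ≠ 0 → b ≼[m] a) : m.degree f = a := by
  apply m.toSyn.injective
  refine le_antisymm ?_ (m.le_degree (mem_support_iff.2 ha))
  exact m.degree_le_iff.2 fun b hb => h b (mem_support_iff.1 hb)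

/-- One division step. The proviso of a nonzero remainder is needed since `m.degree 0 = 0`: the
degree cannot drop when `f` is a constant. -/
theorem exists_reduction (m : MonomialOrder σ) {f b : MvPolynomial σ K} (hf : f ≠ 0) (hb : b ≠ 0)
    (h : m.degree b ≤ m.degree f) :
    ∃ c : K, c ≠ 0 ∧
      (f - monomial (m.degree f - m.degree b) c * b ≠ 0 →
        m.degree (f - monomial (m.degree f - m.degree b) c * b) ≺[m] m.degree f) := by
  have hb' : m.leadingCoeff b ≠ 0 := m.leadingCoeff_ne_zero_iff.2 hb
  have hf' : m.leadingCoeff f ≠ 0 := m.leadingCoeff_ne_zero_iff.2 hf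
  set c : K := m.leadingCoeff f / m.leadingCoeff b
  have hc : c ≠ 0 := div_ne_zero hf' hb'
  refine ⟨c, hc, fun hne => ?_⟩
  set p := monomial (m.degree f - m.degree b) c * b
  have hm : monomial (m.degree f - m.degree b) c ≠ (0 : MvPolynomial σ K) := by
    simpa [monomial_eq_zero] using hc
  have hdm : m.degree (monomial (m.degree f - m.degree b) c : MvPolynomial σ K) =
      m.degree f - m.degree b := by
    classical rw [m.degree_monomial, if_neg hc]
  have hdp : m.degree p = m.degree f := by
    rw [m.degree_mul hm hb, hdm, tsub_add_cancel_of_le h]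
  have hlp : m.leadingCoeff p = m.leadingCoeff f := by
    rw [m.leadingCoeff_mul, m.leadingCoeff_monomial, div_mul_cancel₀ _ hb']
  have hle : m.degree (f - p) ≼[m] m.degree f := by
    refine (m.degree_sub_le).trans ?_
    rw [hdp, sup_idem]
  refine lt_of_le_of_ne hle fun heq => ?_
  have h1 := m.coeff_degree_ne_zero_iff.2 hne
  rw [m.toSyn.injective heq, coeff_sub] at h1
  apply h1
  have : p.coeff (m.degree f) = m.leadingCoeff p := by rw [← hdp]; rfl
  rw [this, hlp]
  exact sub_self _

/-- The division algorithm as an induction principle: every element of `I` reduces to `0`, so a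
property may be carried back along reduction steps. -/
theorem LeadsIdeal.induction {m : MonomialOrder σ} {B : Set (MvPolynomial σ K)}
    {I : Ideal (MvPolynomial σ K)} (h : LeadsIdeal m B I) {P : MvPolynomial σ K → Prop}
    (h0 : P 0)
    (hstep : ∀ f ∈ I, f ≠ 0 → ∀ b ∈ B, b ≠ 0 → m.degree b ≤ m.degree f → ∀ c : K, c ≠ 0 →
      (f - monomial (m.degree f - m.degree b) c * b ≠ 0 →
        m.degree (f - monomial (m.degree f - m.degree b) c * b) ≺[m] m.degree f) →
      P (f - monomial (m.degree f - m.degree b) c * b) → P f) :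
    ∀ f ∈ I, P f := by
  suffices H : ∀ s : m.syn, ∀ f ∈ I, m.toSyn (m.degree f) = s → P f from
    fun f hf => H _ f hf rfl
  intro s
  induction s using WellFoundedLT.induction with
  | ind s ih =>
    intro f hf hs
    by_cases hf0 : f = 0
    · rw [hf0]; exact h0
    obtain ⟨b, hb, hb0, hle⟩ := h.2 f hf hf0
    obtain ⟨c, hc, hlt⟩ := exists_reduction m hf0 hb0 hle
    refine hstep f hf hf0 b hb hb0 hle c hc hlt ?_
    have hmem : f - monomial (m.degree f - m.degree b) c * b ∈ I :=
      I.sub_mem hf (I.mul_mem_left _ (h.1 hb))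
    by_cases hne : f - monomial (m.degree f - m.degree b) c * b = 0
    · rw [hne]; exact h0
    · exact ih _ (hs ▸ hlt hne) _ hmem rfl

theorem LeadsIdeal.span_eq {m : MonomialOrder σ} {B : Set (MvPolynomial σ K)}
    {I : Ideal (MvPolynomial σ K)} (h : LeadsIdeal m B I) : Ideal.span B = I := by
  refine le_antisymm (Ideal.span_le.2 h.1) ?_
  refine h.induction (P := fun f => f ∈ Ideal.span B) (Ideal.zero_mem _) ?_
  intro f _ _ b hb _ _ c _ _ hP
  have := Ideal.add_mem _ hP ((Ideal.span B).mul_mem_left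
    (monomial (m.degree f - m.degree b) c) (Ideal.subset_span hb))
  simpa using this

theorem leadsIdeal_self (m : MonomialOrder σ) (I : Ideal (MvPolynomial σ K)) :
    LeadsIdeal m (I : Set (MvPolynomial σ K)) I :=
  ⟨subset_rfl, fun f hf hf0 => ⟨f, hf, hf0, le_rfl⟩⟩

/-- Leading coefficients are units. Zero must be excluded on the right, because `m.degree 0 = 0`
would contribute the monomial `1`. -/
theorem span_leadingTerm_image (m : MonomialOrder σ) (B : Set (MvPolynomial σ K)) :
    Ideal.span (m.leadingTerm '' B) =
      Ideal.span ((fun a => monomial a (1 : K)) '' (m.degree '' {b ∈ B | b ≠ 0})) := by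
  apply le_antisymm
  · rw [Ideal.span_le]
    rintro _ ⟨b, hb, rfl⟩
    by_cases hb0 : b = 0
    · simp [hb0]
    · have : m.leadingTerm b = C (m.leadingCoeff b) * monomial (m.degree b) 1 := by
        rw [MonomialOrder.leadingTerm, C_mul_monomial, mul_one]
      rw [this]
      exact Ideal.mul_mem_left _ _ (Ideal.subset_span ⟨_, ⟨b, ⟨hb, hb0⟩, rfl⟩, rfl⟩)
  · rw [Ideal.span_le]
    rintro _ ⟨_, ⟨b, ⟨hb, hb0⟩, rfl⟩, rfl⟩
    have : monomial (m.degree b) (1 : K) = C (m.leadingCoeff b)⁻¹ * m.leadingTerm b := by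
      rw [MonomialOrder.leadingTerm, C_mul_monomial,
        inv_mul_cancel₀ (m.leadingCoeff_ne_zero_iff.2 hb0)]
    simp only [SetLike.mem_coe]
    rw [this]
    exact Ideal.mul_mem_left _ _ (Ideal.subset_span ⟨b, hb, rfl⟩)

theorem monomial_mem_span_leadingTerm_iff (m : MonomialOrder σ) (B : Set (MvPolynomial σ K))
    (a : σ →₀ ℕ) : monomial a (1 : K) ∈ Ideal.span (m.leadingTerm '' B) ↔
      ∃ b ∈ B, b ≠ 0 ∧ m.degree b ≤ a := by
  rw [span_leadingTerm_image, mem_ideal_span_monomial_image]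
  classical
  simp [support_monomial, and_assoc]

theorem isGroebnerBasisOf_iff (m : MonomialOrder σ) (B : Set (MvPolynomial σ K))
    (I : Ideal (MvPolynomial σ K)) :
    IsGroebnerBasisOf m B I ↔ B.Finite ∧ LeadsIdeal m B I := by
  unfold IsGroebnerBasisOf LeadsIdeal
  refine and_congr_right fun _ => and_congr_right fun hB => ?_
  constructor
  · intro h f hf hf0
    rw [← monomial_mem_span_leadingTerm_iff, h]
    exact (monomial_mem_span_leadingTerm_iff m _ _).2 ⟨f, hf, hf0, le_rfl⟩
  · intro h
    refine le_antisymm (Ideal.span_mono (Set.image_mono hB)) ?_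
    rw [initialIdeal, span_leadingTerm_image, Ideal.span_le]
    rintro _ ⟨_, ⟨f, ⟨hf, hf0⟩, rfl⟩, rfl⟩
    exact (monomial_mem_span_leadingTerm_iff m _ _).2 (h f hf hf0)

/-- The set of leading exponents of `I` is closed under enlarging the exponents and under taking
square-free parts. -/
def HasSquarefreeLeads (m : MonomialOrder σ) (I : Ideal (MvPolynomial σ K)) : Prop :=
  ∀ f ∈ I, f ≠ 0 → ∀ β : σ →₀ ℕ, (∀ i, β i = 0 → m.degree f i = 0) →
    ∃ g ∈ I, g ≠ 0 ∧ m.degree g ≤ β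

theorem isSquarefreeMonomialIdeal_initialIdeal_iff (m : MonomialOrder σ)
    (I : Ideal (MvPolynomial σ K)) :
    IsSquarefreeMonomialIdeal (initialIdeal m I) ↔ HasSquarefreeLeads m I := by
  classical
  constructor
  · rintro ⟨A, hA, hI⟩ f hf hf0 β hβ
    have h1 : monomial (m.degree f) (1 : K) ∈ initialIdeal m I :=
      (monomial_mem_span_leadingTerm_iff m _ _).2 ⟨f, hf, hf0, le_rfl⟩
    rw [hI, mem_ideal_span_monomial_image] at h1
    obtain ⟨a, haA, ha⟩ := h1 (m.degree f) (by simp [support_monomial])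
    refine (monomial_mem_span_leadingTerm_iff m (I : Set (MvPolynomial σ K)) β).1 ?_
    have : monomial β (1 : K) ∈ initialIdeal m I := by
      rw [hI, mem_ideal_span_monomial_image]
      intro x hx
      rw [support_monomial, if_neg one_ne_zero, Finset.mem_singleton] at hx
      subst hx
      refine ⟨a, haA, fun i => ?_⟩
      by_cases hi : x i = 0
      · have := ha i
        rw [hβ i hi] at this
        omega
      · exact (hA a haA i).trans (Nat.one_le_iff_ne_zero.2 hi)
    exact this
  · intro h
    refine ⟨{a | (∀ i, a i ≤ 1) ∧ monomial a (1 : K) ∈ initialIdeal m I}, fun a ha => ha.1, ?_⟩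
    apply le_antisymm
    · conv_lhs => rw [initialIdeal, span_leadingTerm_image]
      rw [Ideal.span_le]
      rintro _ ⟨_, ⟨f, ⟨hf, hf0⟩, rfl⟩, rfl⟩
      simp only [SetLike.mem_coe]
      rw [mem_ideal_span_monomial_image]
      intro x hx
      rw [support_monomial, if_neg one_ne_zero, Finset.mem_singleton] at hx
      subst hx
      -- The square-free part of the leading exponent.
      set r : σ →₀ ℕ := (m.degree f).mapRange (fun j => min j 1) (by simp)
      have hr : ∀ i, r i = min (m.degree f i) 1 := fun i => Finsupp.mapRange_apply ..
      have hmem : monomial r (1 : K) ∈ initialIdeal m I :=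
        (monomial_mem_span_leadingTerm_iff m (I : Set (MvPolynomial σ K)) r).2
          (h f hf hf0 r fun i hi => by have := hr i; omega)
      exact ⟨r, ⟨fun i => (hr i).le.trans (min_le_right _ _), hmem⟩,
        fun i => (hr i).le.trans (min_le_left _ _)⟩
    · rw [Ideal.span_le]
      rintro _ ⟨a, ha, rfl⟩
      exact ha.2

/-- If `f ^ k ∈ I`, its leading exponent is supported on that of `f`, so some `g ∈ I` has leading
exponent dividing that of `f`. Subtracting a multiple of `g` keeps `f` in the radical and lowers its
degree. -/
theorem HasSquarefreeLeads.isRadical {m : MonomialOrder σ} {I : Ideal (MvPolynomial σ K)}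
    (h : HasSquarefreeLeads m I) : I.IsRadical := by
  suffices H : ∀ s : m.syn, ∀ f, f ∈ I.radical → m.toSyn (m.degree f) = s → f ∈ I from
    fun f hf => H _ f hf rfl
  intro s
  induction s using WellFoundedLT.induction with
  | ind s ih =>
    intro f hf hs
    by_cases hf0 : f = 0
    · rw [hf0]; exact I.zero_mem
    obtain ⟨k, hk⟩ := hf
    obtain ⟨g, hg, hg0, hle⟩ := h (f ^ k) hk (pow_ne_zero _ hf0) (m.degree f) fun i hi => by
      rw [m.degree_pow]; simp [hi]
    obtain ⟨c, hc, hlt⟩ := exists_reduction m hf0 hg0 hle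
    set p := monomial (m.degree f - m.degree g) c * g
    have hp : p ∈ I := I.mul_mem_left _ hg
    have : f - p ∈ I := by
      by_cases hne : f - p = 0
      · rw [hne]; exact I.zero_mem
      · exact ih _ (hs ▸ hlt hne) _
          (I.radical.sub_mem ⟨k, hk⟩ (Ideal.le_radical hp)) rfl
    simpa using I.add_mem this hp

end Groebner

/-! ### Initial `y`-forms, their coefficients, and the ideals `C` and `N`. -/

section InitialForms

variable {σ K : Type*} [Field K]

theorem coeff_initialForm (y : σ) (f : MvPolynomial σ K) (a : σ →₀ ℕ) :
    (initialForm y f).coeff a = if a y = f.degreeOf y then f.coeff a else 0 := by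
  classical
  rw [initialForm, coeff_sum]
  simp only [coeff_monomial]
  rw [Finset.sum_ite_eq']
  simp only [Finset.mem_filter, mem_support_iff]
  split_ifs <;> simp_all

theorem initialForm_eq_mul (y : σ) (f : MvPolynomial σ K) :
    initialForm y f = monomial (Finsupp.single y (f.degreeOf y)) 1 * initialFormCoeff y f := by
  classical
  simp only [initialForm, initialFormCoeff, Finset.mul_sum, monomial_mul, one_mul]
  refine Finset.sum_congr rfl fun a ha => ?_
  rw [← (Finset.mem_filter.1 ha).2, Finsupp.single_add_erase]

/-- The substitution `y = 1`. -/
def substOne (K : Type*) [Field K] (y : σ) : MvPolynomial σ K →ₐ[K] MvPolynomial σ K :=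
  open Classical in aeval fun i => if i = y then 1 else X i

theorem substOne_monomial (y : σ) (a : σ →₀ ℕ) (c : K) :
    substOne K y (monomial a c) = monomial (a.erase y) c := by
  classical
  rw [substOne, aeval_monomial, monomial_eq (s := a.erase y)]
  simp only [algebraMap_eq]
  congr 1
  rw [← Finsupp.mul_prod_erase' a y _ (by simp), if_pos rfl, one_pow, one_mul]
  refine Finsupp.prod_congr fun i hi => ?_
  rw [if_neg]
  rintro rfl
  simp at hi

theorem substOne_initialForm (y : σ) (f : MvPolynomial σ K) :
    substOne K y (initialForm y f) = initialFormCoeff y f := by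
  simp only [initialForm, initialFormCoeff, map_sum, substOne_monomial]

/-- Shows that `C` depends on `B` only through the ideal generated by its initial forms, which is
`in_y(I)` for a Groebner basis in a compatible order. -/
theorem idealC_eq_map (y : σ) (B : Set (MvPolynomial σ K)) :
    idealC y B = (Ideal.span (initialForm y '' B)).map (substOne K y) := by
  rw [Ideal.map_span, ← Set.image_comp, idealC]
  congr 1
  exact Set.image_congr fun f _ => (substOne_initialForm y f).symm

theorem initialForm_eq_self_of_degreeOf_eq_zero {y : σ} {f : MvPolynomial σ K}
    (h : f.degreeOf y = 0) : initialForm y f = f := by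
  classical
  ext a
  rw [coeff_initialForm, h]
  split_ifs with ha
  · rfl
  · by_contra hne
    exact ha (Nat.le_zero.1 (h ▸ monomial_le_degreeOf y (mem_support_iff.2 (Ne.symm hne))))

theorem initialFormCoeff_eq_self_of_degreeOf_eq_zero {y : σ} {f : MvPolynomial σ K}
    (h : f.degreeOf y = 0) : initialFormCoeff y f = f := by
  have := initialForm_eq_mul y f
  rw [initialForm_eq_self_of_degreeOf_eq_zero h, h] at this
  simpa using this.symm

/-- `C` lies in the saturation of `in_y(I)` by `y`: this is clear for each `q_i`, and a finite sum
needs only one common power. -/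
theorem exists_pow_mul_mem_initialFormIdeal {y : σ} {I : Ideal (MvPolynomial σ K)}
    {h : MvPolynomial σ K} (hh : h ∈ idealC y (I : Set (MvPolynomial σ K))) :
    ∃ D : ℕ, monomial (Finsupp.single y D) 1 * h ∈ initialFormIdeal y I := by
  induction hh using Submodule.span_induction with
  | mem q hq =>
    obtain ⟨f, hf, rfl⟩ := hq
    refine ⟨f.degreeOf y, ?_⟩
    rw [← initialForm_eq_mul]
    exact Ideal.subset_span ⟨f, hf, rfl⟩
  | zero => exact ⟨0, by simp⟩
  | add p q _ _ hp hq =>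
    obtain ⟨D, hD⟩ := hp
    obtain ⟨D', hD'⟩ := hq
    refine ⟨D + D', ?_⟩
    have key : (monomial (Finsupp.single y (D + D')) 1 : MvPolynomial σ K) * (p + q) =
        monomial (Finsupp.single y D') 1 * (monomial (Finsupp.single y D) 1 * p) +
        monomial (Finsupp.single y D) 1 * (monomial (Finsupp.single y D') 1 * q) := by
      have : (monomial (Finsupp.single y (D + D')) 1 : MvPolynomial σ K) =
          monomial (Finsupp.single y D) 1 * monomial (Finsupp.single y D') 1 := by
        rw [monomial_mul, one_mul, Finsupp.single_add]
      rw [this]; ring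
    rw [key]
    exact Ideal.add_mem _ (Ideal.mul_mem_left _ _ hD) (Ideal.mul_mem_left _ _ hD')
  | smul r q _ hq =>
    obtain ⟨D, hD⟩ := hq
    refine ⟨D, ?_⟩
    rw [smul_eq_mul, mul_left_comm]
    exact Ideal.mul_mem_left _ _ hD

theorem initialFormIdeal_le_idealC (y : σ) (I : Ideal (MvPolynomial σ K)) :
    initialFormIdeal y I ≤ idealC y (I : Set (MvPolynomial σ K)) := by
  refine Ideal.span_le.2 ?_
  rintro _ ⟨f, hf, rfl⟩
  rw [initialForm_eq_mul]
  exact Ideal.mul_mem_left _ _ (Ideal.subset_span ⟨f, hf, rfl⟩)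

/-- Every `y`-homogeneous component of an element of `in_y(I)` is the component of top degree of
an element of `I`. -/
theorem exists_component_of_mem_initialFormIdeal {y : σ} {I : Ideal (MvPolynomial σ K)}
    {h : MvPolynomial σ K} (hh : h ∈ initialFormIdeal y I) (d : ℕ) :
    ∃ f ∈ I, ∀ a : σ →₀ ℕ, (d < a y → f.coeff a = 0) ∧ (a y = d → f.coeff a = h.coeff a) := by
  classical
  induction hh using Submodule.span_induction generalizing d with
  | mem q hq =>
    obtain ⟨f, hf, rfl⟩ := hq
    by_cases hd : d = f.degreeOf y
    · refine ⟨f, hf, fun a => ⟨fun ha => ?_, fun ha => ?_⟩⟩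
      · by_contra hne
        exact absurd (monomial_le_degreeOf y (mem_support_iff.2 hne)) (by omega)
      · rw [coeff_initialForm, if_pos (ha.trans hd)]
    · refine ⟨0, I.zero_mem, fun a => ⟨fun _ => coeff_zero _, fun ha => ?_⟩⟩
      rw [coeff_initialForm, if_neg (by omega), coeff_zero]
  | zero => exact ⟨0, I.zero_mem, fun a => by simp⟩
  | add p q _ _ hp hq =>
    obtain ⟨f, hf, hf'⟩ := hp d
    obtain ⟨g, hg, hg'⟩ := hq d
    refine ⟨f + g, I.add_mem hf hg, fun a => ⟨fun ha => ?_, fun ha => ?_⟩⟩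
    · rw [coeff_add, (hf' a).1 ha, (hg' a).1 ha, add_zero]
    · rw [coeff_add, coeff_add, (hf' a).2 ha, (hg' a).2 ha]
  | smul r q _ hq =>
    rw [smul_eq_mul]
    induction r using MvPolynomial.induction_on generalizing d with
    | C c =>
      obtain ⟨f, hf, hf'⟩ := hq d
      refine ⟨C c * f, I.mul_mem_left _ hf, fun a => ⟨fun ha => ?_, fun ha => ?_⟩⟩
      · rw [coeff_C_mul, (hf' a).1 ha, mul_zero]
      · rw [coeff_C_mul, coeff_C_mul, (hf' a).2 ha]
    | add r s hr hs =>
      obtain ⟨f, hf, hf'⟩ := hr d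
      obtain ⟨g, hg, hg'⟩ := hs d
      refine ⟨f + g, I.add_mem hf hg, fun a => ⟨fun ha => ?_, fun ha => ?_⟩⟩
      · rw [coeff_add, (hf' a).1 ha, (hg' a).1 ha, add_zero]
      · rw [add_mul, coeff_add, coeff_add, (hf' a).2 ha, (hg' a).2 ha]
    | mul_X r i hr =>
      rw [mul_comm r, mul_assoc]
      -- Multiplication by `y` raises the `y`-degree of a component by one; any other variable
      -- preserves it.
      by_cases hi : i = y
      · subst hi
        obtain _ | d := d
        · refine ⟨0, I.zero_mem, fun a => ⟨fun _ => coeff_zero _, fun ha => ?_⟩⟩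
          rw [coeff_X_mul', if_neg (by simpa using ha), coeff_zero]
        · obtain ⟨f, hf, hf'⟩ := hr d
          refine ⟨X i * f, I.mul_mem_left _ hf, fun a => ?_⟩
          rw [coeff_X_mul', coeff_X_mul']
          have := hf' (a - Finsupp.single i 1)
          simp only [Finsupp.coe_tsub, Pi.sub_apply, Finsupp.single_eq_same] at this
          constructor
          · intro ha
            rw [this.1 (by omega), ite_self]
          · intro ha
            rw [this.2 (by omega)]
      · obtain ⟨f, hf, hf'⟩ := hr d
        refine ⟨X i * f, I.mul_mem_left _ hf, fun a => ?_⟩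
        rw [coeff_X_mul', coeff_X_mul']
        have := hf' (a - Finsupp.single i 1)
        simp only [Finsupp.coe_tsub, Pi.sub_apply, Finsupp.single_eq_of_ne (Ne.symm hi),
          tsub_zero] at this
        constructor
        · intro ha
          rw [this.1 ha, ite_self]
        · intro ha
          rw [this.2 ha]

/-! ### Monomial orders that compare the exponent of `y` first. -/

section Compatible

variable {m : MonomialOrder σ} {y : σ} (hy : ∀ a b : σ →₀ ℕ, a y < b y → a ≺[m] b)

include hy

theorem degreeOf_eq_degree_apply (f : MvPolynomial σ K) :
    f.degreeOf y = m.degree f y := by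
  by_cases hf : f = 0
  · simp [hf]
  refine le_antisymm (degreeOf_le_iff.2 fun a ha => ?_)
    (monomial_le_degreeOf y (m.degree_mem_support hf))
  by_contra hlt
  exact absurd (m.le_degree ha) (not_le.2 (hy _ _ (not_le.1 hlt)))

theorem coeff_degree_initialForm (f : MvPolynomial σ K) :
    (initialForm y f).coeff (m.degree f) = f.coeff (m.degree f) := by
  classical
  rw [coeff_initialForm, if_pos (degreeOf_eq_degree_apply hy f).symm]

theorem initialForm_ne_zero {f : MvPolynomial σ K} (hf : f ≠ 0) : initialForm y f ≠ 0 := by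
  intro h
  have := coeff_degree_initialForm hy f
  rw [h, coeff_zero] at this
  exact m.coeff_degree_ne_zero_iff.2 hf this.symm

theorem degree_initialForm (f : MvPolynomial σ K) : m.degree (initialForm y f) = m.degree f := by
  classical
  by_cases hf : f = 0
  · subst hf; simp [initialForm]
  refine degree_eq_of_forall_le ?_ fun b hb => ?_
  · rw [coeff_degree_initialForm hy]
    exact m.coeff_degree_ne_zero_iff.2 hf
  · rw [coeff_initialForm] at hb
    exact m.le_degree (mem_support_iff.2 fun h => hb (by simp [h]))

theorem initialFormCoeff_ne_zero {f : MvPolynomial σ K} (hf : f ≠ 0) :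
    initialFormCoeff y f ≠ 0 := by
  intro h
  apply initialForm_ne_zero hy hf
  rw [initialForm_eq_mul, h, mul_zero]

theorem degree_initialFormCoeff (f : MvPolynomial σ K) :
    m.degree (initialFormCoeff y f) = (m.degree f).erase y := by
  by_cases hf : f = 0
  · subst hf; simp [initialFormCoeff]
  classical
  have h := degree_initialForm hy f
  rw [initialForm_eq_mul, m.degree_mul (by simp [monomial_eq_zero])
    (initialFormCoeff_ne_zero hy hf), m.degree_monomial, if_neg one_ne_zero,
    degreeOf_eq_degree_apply hy] at h
  refine add_left_cancel (a := Finsupp.single y (m.degree f y)) ?_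
  rw [h, Finsupp.single_add_erase]

/-- Follow the initial form through one reduction step. If the `y`-degree survives, the initial
forms subtract; if it drops, the initial form of `f` equals the multiple of that of `b`. -/
theorem LeadsIdeal.initialFormIdeal_eq {B : Set (MvPolynomial σ K)}
    {I : Ideal (MvPolynomial σ K)} (h : LeadsIdeal m B I) :
    initialFormIdeal y I = Ideal.span (initialForm y '' B) := by
  classical
  refine le_antisymm ?_ (Ideal.span_mono (Set.image_mono h.1))
  rw [initialFormIdeal, Ideal.span_le]
  rintro _ ⟨f, hf, rfl⟩
  refine h.induction (P := fun f => initialForm y f ∈ Ideal.span (initialForm y '' B))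
    (by simp [initialForm]) ?_ f hf
  clear hf f
  intro f hf hf0 b hb hb0 hle c hc hlt hP
  set p := monomial (m.degree f - m.degree b) c * b with hp
  have hbI : monomial (m.degree f - m.degree b) c * initialForm y b ∈
      Ideal.span (initialForm y '' B) :=
    Ideal.mul_mem_left _ _ (Ideal.subset_span ⟨b, hb, rfl⟩)
  have hcoef : ∀ a : σ →₀ ℕ, (monomial (m.degree f - m.degree b) c * initialForm y b).coeff a =
      if a y = f.degreeOf y then p.coeff a else 0 := by
    intro a
    rw [hp, coeff_monomial_mul', coeff_monomial_mul', coeff_initialForm,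
      degreeOf_eq_degree_apply hy, degreeOf_eq_degree_apply hy]
    by_cases ha : m.degree f - m.degree b ≤ a
    · rw [if_pos ha, if_pos ha]
      have h1 := ha y
      have h2 := hle y
      have h4 : (a - (m.degree f - m.degree b)) y = a y - (m.degree f y - m.degree b y) := rfl
      have h5 : (m.degree f - m.degree b) y = m.degree f y - m.degree b y := rfl
      by_cases h3 : a y = m.degree f y
      · rw [if_pos h3, if_pos (by omega)]
      · rw [if_neg h3, if_neg (by omega), mul_zero]
    · simp [ha]
  have hsub : initialForm y f - monomial (m.degree f - m.degree b) c * initialForm y b ∈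
      Ideal.span (initialForm y '' B) := by
    have hle' : (f - p).degreeOf y ≤ f.degreeOf y := by
      by_cases hne : f - p = 0
      · simp [hne]
      · rw [degreeOf_eq_degree_apply hy, degreeOf_eq_degree_apply hy]
        by_contra hlt'
        exact absurd (hlt hne) (not_lt.2 (hy _ _ (not_le.1 hlt')).le)
    have hco : ∀ a, (initialForm y f - monomial (m.degree f - m.degree b) c *
        initialForm y b).coeff a = if a y = f.degreeOf y then (f - p).coeff a else 0 := by
      intro a
      rw [coeff_sub, hcoef, coeff_initialForm, coeff_sub]
      split_ifs <;> simp
    obtain heq | hlt' := hle'.eq_or_lt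
    · convert hP using 1
      ext a
      rw [hco, coeff_initialForm, heq]
    · convert Ideal.zero_mem _ using 1
      ext a
      rw [hco, coeff_zero]
      split_ifs with ha
      · by_contra hne
        exact absurd (monomial_le_degreeOf y (mem_support_iff.2 hne)) (by omega)
      · rfl
  simpa using Ideal.add_mem _ hsub hbI

theorem LeadsIdeal.idealC_eq {B : Set (MvPolynomial σ K)}
    {I : Ideal (MvPolynomial σ K)} (h : LeadsIdeal m B I) :
    idealC y B = idealC y (I : Set (MvPolynomial σ K)) := by
  rw [idealC_eq_map, idealC_eq_map, ← h.initialFormIdeal_eq hy]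
  rfl

theorem degreeOf_eq_zero_of_degree_le {f g : MvPolynomial σ K} (hf : f.degreeOf y = 0)
    (hle : m.degree g ≤ m.degree f) : g.degreeOf y = 0 := by
  rw [degreeOf_eq_degree_apply hy] at hf ⊢
  have := hle y
  omega

/-- The elimination property: a leading exponent free of `y` forces the whole polynomial to be free
of `y`, so reducing a `y`-free element uses only `y`-free members of `B`. -/
theorem LeadsIdeal.mem_span_of_degreeOf_eq_zero {B : Set (MvPolynomial σ K)}
    {I : Ideal (MvPolynomial σ K)} (h : LeadsIdeal m B I) :
    ∀ f ∈ I, f.degreeOf y = 0 → f ∈ Ideal.span {b ∈ B | b.degreeOf y = 0} := by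
  refine h.induction (fun _ => Ideal.zero_mem _) ?_
  intro f hf hf0 b hb hb0 hle c hc hlt hP hfy
  have hby : b.degreeOf y = 0 := degreeOf_eq_zero_of_degree_le hy hfy hle
  have hlast : (f - monomial (m.degree f - m.degree b) c * b).degreeOf y = 0 := by
    by_cases hne : f - monomial (m.degree f - m.degree b) c * b = 0
    · simp [hne]
    · rw [degreeOf_eq_degree_apply hy] at hfy ⊢
      by_contra hpos
      exact absurd (hlt hne) (not_lt.2 (hy _ _ (by omega)).le)
  have := Ideal.add_mem _ (hP hlast) (Ideal.mul_mem_left _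
    (monomial (m.degree f - m.degree b) c)
    (Ideal.subset_span (s := {b ∈ B | b.degreeOf y = 0}) ⟨hb, hby⟩))
  simpa using this

omit hy in
theorem idealN_eq_span (y : σ) (B : Set (MvPolynomial σ K)) :
    idealN y B = Ideal.span {b ∈ B | b.degreeOf y = 0} := by
  unfold idealN
  congr 1
  ext f
  constructor
  · rintro ⟨g, hg, rfl⟩
    rwa [initialFormCoeff_eq_self_of_degreeOf_eq_zero hg.2]
  · intro hf
    exact ⟨f, hf, initialFormCoeff_eq_self_of_degreeOf_eq_zero hf.2⟩

theorem LeadsIdeal.idealN_eq {B : Set (MvPolynomial σ K)}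
    {I : Ideal (MvPolynomial σ K)} (h : LeadsIdeal m B I) :
    idealN y B = idealN y (I : Set (MvPolynomial σ K)) := by
  rw [idealN_eq_span, idealN_eq_span]
  refine le_antisymm (Ideal.span_mono fun b hb => ⟨h.1 hb.1, hb.2⟩) (Ideal.span_le.2 ?_)
  rintro f ⟨hf, hfy⟩
  exact h.mem_span_of_degreeOf_eq_zero hy f hf hfy

/-- Lift the component of `h` of top `y`-degree to `I`: the other terms of the lift have smaller
`y`-degree and cannot lead. So passing to `in_y(I)` creates no new leading exponents. -/
theorem exists_degree_eq_of_mem_initialFormIdeal {I : Ideal (MvPolynomial σ K)}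
    {h : MvPolynomial σ K} (hh : h ∈ initialFormIdeal y I) (h0 : h ≠ 0) :
    ∃ f ∈ I, f ≠ 0 ∧ m.degree f = m.degree h := by
  obtain ⟨f, hf, hc⟩ := exists_component_of_mem_initialFormIdeal hh (m.degree h y)
  have hne : f.coeff (m.degree h) ≠ 0 := by
    rw [(hc _).2 rfl]
    exact m.coeff_degree_ne_zero_iff.2 h0
  refine ⟨f, hf, fun hz => hne (by simp [hz]), degree_eq_of_forall_le hne fun b hb => ?_⟩
  obtain hlt | heq | hgt := lt_trichotomy (b y) (m.degree h y)
  · exact (hy _ _ hlt).le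
  · rw [(hc b).2 heq] at hb
    exact m.le_degree (mem_support_iff.2 hb)
  · exact absurd ((hc b).1 hgt) hb

theorem HasSquarefreeLeads.initialFormIdeal {I : Ideal (MvPolynomial σ K)}
    (h : HasSquarefreeLeads m I) : HasSquarefreeLeads m (initialFormIdeal y I) := by
  intro p hp hp0 β hβ
  obtain ⟨f, hf, hf0, hd⟩ := exists_degree_eq_of_mem_initialFormIdeal hy hp hp0
  obtain ⟨g, hg, hg0, hle⟩ := h f hf hf0 β (by rwa [hd])
  exact ⟨initialForm y g, Ideal.subset_span ⟨g, hg, rfl⟩, initialForm_ne_zero hy hg0,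
    by rwa [degree_initialForm hy]⟩

theorem exists_degree_eq_of_mem_idealC {I : Ideal (MvPolynomial σ K)}
    {h : MvPolynomial σ K} (hh : h ∈ idealC y (I : Set (MvPolynomial σ K))) (h0 : h ≠ 0) :
    ∃ D : ℕ, ∃ f ∈ I, f ≠ 0 ∧ m.degree f = Finsupp.single y D + m.degree h := by
  classical
  obtain ⟨D, hD⟩ := exists_pow_mul_mem_initialFormIdeal hh
  have hm : (monomial (Finsupp.single y D) 1 : MvPolynomial σ K) ≠ 0 := by
    simp [monomial_eq_zero]
  obtain ⟨f, hf, hf0, hd⟩ := exists_degree_eq_of_mem_initialFormIdeal hy hD (mul_ne_zero hm h0)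
  rw [m.degree_mul hm h0, m.degree_monomial, if_neg one_ne_zero] at hd
  exact ⟨D, f, hf, hf0, hd⟩

omit hy in
theorem erase_le_of_le_single_add {a b : σ →₀ ℕ} {D : ℕ} (h : a ≤ Finsupp.single y D + b) :
    a.erase y ≤ b := by
  intro i
  by_cases hi : i = y
  · subst hi; simp
  · have := h i
    simpa [Finsupp.erase_ne hi, Finsupp.single_eq_of_ne hi] using this

/-- A leading exponent of `C` becomes one of `I` after adding a power of `y`; erasing `y` from a
divisor found in `B` removes that power again. -/
theorem LeadsIdeal.idealC_leads {B : Set (MvPolynomial σ K)}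
    {I : Ideal (MvPolynomial σ K)} (h : LeadsIdeal m B I) :
    LeadsIdeal m (initialFormCoeff y '' B) (idealC y (I : Set (MvPolynomial σ K))) := by
  refine ⟨(Set.image_mono h.1).trans Ideal.subset_span, fun p hp hp0 => ?_⟩
  obtain ⟨D, f, hf, hf0, hd⟩ := exists_degree_eq_of_mem_idealC hy hp hp0
  obtain ⟨b, hb, hb0, hle⟩ := h.2 f hf hf0
  refine ⟨_, ⟨b, hb, rfl⟩, initialFormCoeff_ne_zero hy hb0, ?_⟩
  rw [degree_initialFormCoeff hy]
  exact erase_le_of_le_single_add (hd ▸ hle)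

theorem HasSquarefreeLeads.idealC {I : Ideal (MvPolynomial σ K)}
    (h : HasSquarefreeLeads m I) :
    HasSquarefreeLeads m (idealC y (I : Set (MvPolynomial σ K))) := by
  intro p hp hp0 β hβ
  obtain ⟨D, f, hf, hf0, hd⟩ := exists_degree_eq_of_mem_idealC hy hp hp0
  obtain ⟨g, hg, hg0, hle⟩ := h f hf hf0 (Finsupp.single y D + β) fun i hi => by
    simp only [Finsupp.coe_add, Pi.add_apply, Nat.add_eq_zero_iff] at hi
    rw [hd, Finsupp.add_apply, hi.1, hβ i hi.2]
  refine ⟨_, Ideal.subset_span ⟨g, hg, rfl⟩, initialFormCoeff_ne_zero hy hg0, ?_⟩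
  rw [degree_initialFormCoeff hy]
  exact erase_le_of_le_single_add hle

/-- Only the inclusion of the intersection in `in_y(I)` needs square-freeness, through the
radicality of `in_y(I)`. -/
theorem HasSquarefreeLeads.initialFormIdeal_eq_inf {I : Ideal (MvPolynomial σ K)}
    (h : HasSquarefreeLeads m I) :
    _root_.initialFormIdeal y I = _root_.idealC y (I : Set (MvPolynomial σ K)) ⊓
      (idealN y (I : Set (MvPolynomial σ K)) ⊔ Ideal.span {X y}) := by
  have hN : idealN y (I : Set (MvPolynomial σ K)) ≤ _root_.initialFormIdeal y I := by
    rw [idealN_eq_span, Ideal.span_le]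
    rintro f ⟨hf, hfy⟩
    rw [← initialForm_eq_self_of_degreeOf_eq_zero hfy]
    exact Ideal.subset_span ⟨f, hf, rfl⟩
  have hrad := (h.initialFormIdeal hy).isRadical
  apply le_antisymm
  · refine le_inf (initialFormIdeal_le_idealC y I) (Ideal.span_le.2 ?_)
    rintro _ ⟨f, hf, rfl⟩
    by_cases hfy : f.degreeOf y = 0
    · rw [initialForm_eq_self_of_degreeOf_eq_zero hfy, idealN_eq_span]
      exact Ideal.mem_sup_left (Ideal.subset_span ⟨hf, hfy⟩)
    · refine Ideal.mem_sup_right (Ideal.mem_span_singleton.2 ?_)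
      rw [initialForm_eq_mul, ← X_pow_eq_monomial]
      exact (dvd_pow_self _ hfy).mul_right _
  · rintro p ⟨hpC, hp⟩
    obtain ⟨n, hn, q, hq, rfl⟩ := Submodule.mem_sup.1 hp
    obtain ⟨g, rfl⟩ := Ideal.mem_span_singleton.1 hq
    refine Ideal.add_mem _ (hN hn) ?_
    -- Since `N ⊆ in_y(I) ⊆ C`, the multiple of `y` is itself in `C`.
    have hgC : X y * g ∈ _root_.idealC y (I : Set (MvPolynomial σ K)) := by
      have := Ideal.sub_mem _ hpC (initialFormIdeal_le_idealC y I (hN hn))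
      simpa using this
    obtain ⟨D, hD⟩ := exists_pow_mul_mem_initialFormIdeal hgC
    rw [← X_pow_eq_monomial] at hD
    refine hrad ⟨D + 1, ?_⟩
    have : (X y * g) ^ (D + 1) = g ^ D * (X y ^ D * (X y * g)) := by ring
    rw [this]
    exact Ideal.mul_mem_left _ _ hD

end Compatible

/-- Test compatibility on the sum of the monomials `a` and `b`: if `a` led despite its smaller
`y`-exponent, the initial form would lose the leading term. -/
theorem isCompatibleOrder_iff (m : MonomialOrder σ) (y : σ) :
    IsCompatibleOrder K m y ↔ ∀ a b : σ →₀ ℕ, a y < b y → a ≺[m] b := by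
  classical
  constructor
  · intro h a b hab
    by_contra hlt
    have hne : a ≠ b := by rintro rfl; exact lt_irrefl _ hab
    set f : MvPolynomial σ K := monomial a 1 + monomial b 1
    have hfa : f.coeff a = 1 := by simp [f, coeff_monomial, hne.symm]
    have hfb : f.coeff b = 1 := by simp [f, coeff_monomial, hne]
    have hd : m.degree f = a := by
      refine degree_eq_of_forall_le (by simp [hfa]) fun c hc => ?_
      simp only [f, coeff_add, coeff_monomial] at hc
      by_cases hac : a = c
      · rw [hac]
      by_cases hbc : b = c
      · rw [← hbc]; exact not_lt.1 hlt
      simp [hac, hbc] at hc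
    have hdeg : b y ≤ f.degreeOf y :=
      monomial_le_degreeOf y (mem_support_iff.2 (by simp [hfb]))
    have h1 : (initialForm y f).coeff a = 0 := by
      rw [coeff_initialForm, if_neg (by omega)]
    have h2 := congrArg (coeff a) (h f)
    have h3 : m.degree (initialForm y f) = a := by
      rw [← m.degree_leadingTerm, ← h f, m.degree_leadingTerm, hd]
    simp only [MonomialOrder.leadingTerm, MonomialOrder.leadingCoeff, hd, h3, h1, hfa] at h2
    simp at h2
  · intro hy f
    simp only [MonomialOrder.leadingTerm, MonomialOrder.leadingCoeff]
    rw [degree_initialForm hy, coeff_degree_initialForm hy]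

end InitialForms

/-! ### Ideals generated by polynomials free of `S`, and change of monomial order. -/

section FreeOfVariables

variable {σ K : Type*} [Field K]

/-- No exponent of `f` involves an index of `S`. -/
def FreeOf (S : Set σ) (f : MvPolynomial σ K) : Prop :=
  ∀ a : σ →₀ ℕ, f.coeff a ≠ 0 → ∀ i ∈ S, a i = 0

theorem degreeOf_eq_zero_iff_freeOf (y : σ) (f : MvPolynomial σ K) :
    f.degreeOf y = 0 ↔ FreeOf {y} f := by
  classical
  rw [← Nat.le_zero, degreeOf_le_iff]
  simp [FreeOf]

/-- The coefficient of an `S`-monomial in an element of an ideal generated by `S`-free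
polynomials belongs to the ideal. -/
theorem exists_slice_of_mem_span {S : Set σ} {B : Set (MvPolynomial σ K)}
    (hB : ∀ b ∈ B, FreeOf S b) {f : MvPolynomial σ K} (hf : f ∈ Ideal.span B) (γ : σ →₀ ℕ)
    (hγ : ∀ i ∉ S, γ i = 0) :
    ∃ g ∈ Ideal.span B, FreeOf S g ∧
      ∀ a : σ →₀ ℕ, (∀ i ∈ S, a i = 0) → g.coeff a = f.coeff (a + γ) := by
  classical
  induction hf using Submodule.span_induction generalizing γ with
  | mem b hb =>
    -- The only nonzero slice of an `S`-free generator is the one at `γ = 0`.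
    by_cases h0 : γ = 0
    · exact ⟨b, Ideal.subset_span hb, hB b hb, fun a _ => by simp [h0]⟩
    · refine ⟨0, Ideal.zero_mem _, fun a ha => absurd (coeff_zero a) ha, fun a ha => ?_⟩
      by_contra hne
      apply h0
      ext i
      by_cases hi : i ∈ S
      · have := hB b hb (a + γ) (by simpa [eq_comm] using hne) i hi
        simp only [Finsupp.add_apply] at this
        simp only [Finsupp.coe_zero, Pi.zero_apply]
        omega
      · exact hγ i hi
  | zero =>
    exact ⟨0, Ideal.zero_mem _, fun a ha => absurd (coeff_zero a) ha, fun a _ => by simp⟩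
  | add p q _ _ hp hq =>
    obtain ⟨g, hg, hgS, hg'⟩ := hp γ hγ
    obtain ⟨g', hh, hhS, hh'⟩ := hq γ hγ
    refine ⟨g + g', Ideal.add_mem _ hg hh, fun a ha i hi => ?_, fun a ha => ?_⟩
    · by_cases h1 : g.coeff a = 0
      · exact hhS a (by simpa [h1] using ha) i hi
      · exact hgS a h1 i hi
    · rw [coeff_add, coeff_add, hg' a ha, hh' a ha]
  | smul r q _ hq =>
    rw [smul_eq_mul]
    induction r using MvPolynomial.induction_on generalizing γ with
    | C c =>
      obtain ⟨g, hg, hgS, hg'⟩ := hq γ hγ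
      refine ⟨C c * g, Ideal.mul_mem_left _ _ hg, fun a ha i hi => ?_, fun a ha => ?_⟩
      · rw [coeff_C_mul] at ha
        exact hgS a (right_ne_zero_of_mul ha) i hi
      · rw [coeff_C_mul, coeff_C_mul, hg' a ha]
    | add r s hr hs =>
      obtain ⟨g, hg, hgS, hg'⟩ := hr γ hγ
      obtain ⟨g', hh, hhS, hh'⟩ := hs γ hγ
      refine ⟨g + g', Ideal.add_mem _ hg hh, fun a ha i hi => ?_, fun a ha => ?_⟩
      · by_cases h1 : g.coeff a = 0
        · exact hhS a (by simpa [h1] using ha) i hi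
        · exact hgS a h1 i hi
      · rw [add_mul, coeff_add, coeff_add, hg' a ha, hh' a ha]
    | mul_X r j hr =>
      rw [mul_comm r, mul_assoc]
      -- A variable of `S` shifts the slice index `γ`; any other variable multiplies the slice.
      by_cases hj : j ∈ S
      · by_cases h0 : γ j = 0
        · refine ⟨0, Ideal.zero_mem _, fun a ha => absurd (coeff_zero a) ha, fun a ha => ?_⟩
          rw [coeff_X_mul', if_neg (by simp [ha j hj, h0]), coeff_zero]
        · have hle : Finsupp.single j 1 ≤ γ := by
            rw [Finsupp.single_le_iff]; omega
          obtain ⟨g, hg, hgS, hg'⟩ := hr (γ - Finsupp.single j 1) fun i hi => by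
            simp [hγ i hi]
          refine ⟨g, hg, hgS, fun a ha => ?_⟩
          rw [hg' a ha, coeff_X_mul', if_pos (by simp [h0]), add_tsub_assoc_of_le hle]
      · obtain ⟨g, hg, hgS, hg'⟩ := hr γ hγ
        refine ⟨X j * g, Ideal.mul_mem_left _ _ hg, fun a ha i hi => ?_, fun a ha => ?_⟩
        · rw [coeff_X_mul'] at ha
          split_ifs at ha with h1
          · have := hgS _ ha i hi
            have hij : i ≠ j := fun h => hj (h ▸ hi)
            simpa [Finsupp.single_eq_of_ne hij] using this
          · exact absurd rfl ha
        · rw [coeff_X_mul', coeff_X_mul']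
          have hiff : j ∈ (a + γ).support ↔ j ∈ a.support := by simp [hγ j hj]
          by_cases h1 : j ∈ a.support
          · have hle : Finsupp.single j 1 ≤ a := by
              rw [Finsupp.single_le_iff]
              exact Nat.one_le_iff_ne_zero.2 (Finsupp.mem_support_iff.1 h1)
            rw [if_pos h1, if_pos (hiff.2 h1), hg' _ (fun i hi => by simp [ha i hi]),
              tsub_add_eq_add_tsub hle]
          · rw [if_neg h1, if_neg (fun h => h1 (hiff.1 h))]

/-- Take the slice at the `S`-part `γ` of the leading exponent. Cancelling `γ` from all comparisons
shows that the remaining part `α` leads the slice. -/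
theorem exists_freeOf_of_mem_span (m : MonomialOrder σ) {S : Set σ} {B : Set (MvPolynomial σ K)}
    (hB : ∀ b ∈ B, FreeOf S b) {f : MvPolynomial σ K} (hf : f ∈ Ideal.span B) (hf0 : f ≠ 0) :
    ∃ g ∈ Ideal.span B, FreeOf S g ∧ g ≠ 0 ∧ m.degree g ≤ m.degree f := by
  classical
  set γ := (m.degree f).filter (· ∈ S)
  set α := (m.degree f).filter (· ∉ S)
  have hsum : α + γ = m.degree f := by
    rw [add_comm]; exact Finsupp.filter_add_filter_not ..
  obtain ⟨g, hg, hgS, hg'⟩ := exists_slice_of_mem_span hB hf γ fun i hi =>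
    Finsupp.filter_apply_neg _ _ hi
  have hα : ∀ i ∈ S, α i = 0 := fun i hi => Finsupp.filter_apply_neg _ _ (not_not.2 hi)
  have hne : g.coeff α ≠ 0 := by
    rw [hg' α hα, hsum]
    exact m.coeff_degree_ne_zero_iff.2 hf0
  have hd : m.degree g = α := by
    refine degree_eq_of_forall_le hne fun b hb => ?_
    have h1 : b + γ ≼[m] α + γ := by
      rw [hsum]
      rw [hg' b (hgS b hb)] at hb
      exact m.le_degree (mem_support_iff.2 hb)
    rw [map_add, map_add] at h1
    exact le_of_add_le_add_right h1
  refine ⟨g, hg, hgS, fun h => hne (by simp [h]), ?_⟩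
  rw [hd, ← hsum]
  exact le_self_add

/-- The two orders agree on the exponents that do not involve `S`. -/
def AgreeOff (S : Set σ) (m m' : MonomialOrder σ) : Prop :=
  ∀ a b : σ →₀ ℕ, (∀ i ∈ S, a i = 0) → (∀ i ∈ S, b i = 0) → (a ≼[m] b ↔ a ≼[m'] b)

theorem AgreeOff.symm {S : Set σ} {m m' : MonomialOrder σ} (h : AgreeOff S m m') :
    AgreeOff S m' m :=
  fun a b ha hb => (h a b ha hb).symm

theorem AgreeOff.degree_eq {S : Set σ} {m m' : MonomialOrder σ} (h : AgreeOff S m m')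
    {f : MvPolynomial σ K} (hf : FreeOf S f) : m.degree f = m'.degree f := by
  by_cases hf0 : f = 0
  · simp [hf0]
  symm
  refine degree_eq_of_forall_le (m.coeff_degree_ne_zero_iff.2 hf0) fun b hb => ?_
  exact (h _ _ (hf b hb) (hf _ (m.coeff_degree_ne_zero_iff.2 hf0))).1
    (m.le_degree (mem_support_iff.2 hb))

/-- By slicing, it suffices to divide the leading exponents of `S`-free elements, and for these both
orders select the same exponent. -/
theorem LeadsIdeal.of_agreeOff {S : Set σ} {m m' : MonomialOrder σ} (h : AgreeOff S m m')
    {B : Set (MvPolynomial σ K)} (hB : ∀ b ∈ B, FreeOf S b) {I : Ideal (MvPolynomial σ K)}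
    (hI : LeadsIdeal m B I) : LeadsIdeal m' B I := by
  refine ⟨hI.1, fun f hf hf0 => ?_⟩
  rw [← hI.span_eq] at hf
  obtain ⟨g, hg, hgS, hg0, hle⟩ := exists_freeOf_of_mem_span m' hB hf hf0
  obtain ⟨b, hb, hb0, hle'⟩ := hI.2 g (hI.span_eq ▸ hg) hg0
  refine ⟨b, hb, hb0, le_trans ?_ hle⟩
  rwa [← h.degree_eq (hB b hb), ← h.degree_eq hgS]

theorem HasSquarefreeLeads.of_agreeOff {S : Set σ} {m m' : MonomialOrder σ}
    (h : AgreeOff S m m') {B : Set (MvPolynomial σ K)} (hB : ∀ b ∈ B, FreeOf S b)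
    {I : Ideal (MvPolynomial σ K)} (hI : LeadsIdeal m B I) (hs : HasSquarefreeLeads m I) :
    HasSquarefreeLeads m' I := by
  intro f hf hf0 β hβ
  obtain ⟨b, hb, hb0, hle⟩ := (hI.of_agreeOff h hB).2 f hf hf0
  obtain ⟨g, hg, hg0, hgβ⟩ := hs b (hI.1 hb) hb0 β fun i hi => by
    have h1 := hle i
    rw [hβ i hi] at h1
    rw [h.degree_eq (hB b hb)]
    omega
  obtain ⟨b', hb', hb0', hle'⟩ := hI.2 g hg hg0
  refine ⟨b', hI.1 hb', hb0', ?_⟩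
  rw [← h.degree_eq (hB b' hb')]
  exact hle'.trans hgβ

variable {m : MonomialOrder σ} {y : σ} (hy : ∀ a b : σ →₀ ℕ, a y < b y → a ≺[m] b)

include hy

/-- Slicing reduces to a `y`-free element of `N ⊆ I`; an element of `B` whose leading exponent
divides its own is then `y`-free too. -/
theorem LeadsIdeal.idealN_leads {B : Set (MvPolynomial σ K)}
    {I : Ideal (MvPolynomial σ K)} (h : LeadsIdeal m B I) :
    LeadsIdeal m {b ∈ B | b.degreeOf y = 0} (idealN y (I : Set (MvPolynomial σ K))) := by
  rw [← h.idealN_eq hy, idealN_eq_span]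
  refine ⟨Ideal.subset_span, fun f hf hf0 => ?_⟩
  obtain ⟨g, hg, hgS, hg0, hle⟩ := exists_freeOf_of_mem_span m (S := {y})
    (fun b hb => (degreeOf_eq_zero_iff_freeOf y b).1 hb.2) hf hf0
  have hgI : g ∈ I := Ideal.span_le.2 (fun b hb => h.1 hb.1) hg
  obtain ⟨b, hb, hb0, hle'⟩ := h.2 g hgI hg0
  exact ⟨b, ⟨hb, degreeOf_eq_zero_of_degree_le hy
    ((degreeOf_eq_zero_iff_freeOf y g).2 hgS) hle'⟩, hb0, hle'.trans hle⟩

theorem HasSquarefreeLeads.idealN {I : Ideal (MvPolynomial σ K)}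
    (h : HasSquarefreeLeads m I) :
    HasSquarefreeLeads m (idealN y (I : Set (MvPolynomial σ K))) := by
  intro f hf hf0 β hβ
  obtain ⟨b, hb, hb0, hle⟩ := ((leadsIdeal_self m I).idealN_leads hy).2 f hf hf0
  have hby : m.degree b y = 0 := by rw [← degreeOf_eq_degree_apply hy]; exact hb.2
  -- The exponent of `b` avoids `y`, so `y` may be erased from `β`; this makes `g` free of `y` and
  -- hence a member of `N`.
  obtain ⟨g, hg, hg0, hgβ⟩ := h b hb.1 hb0 (β.erase y) fun i hi => by
    by_cases hiy : i = y
    · rw [hiy, hby]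
    · rw [Finsupp.erase_ne hiy] at hi
      have h1 := hle i
      rw [hβ i hi] at h1
      omega
  refine ⟨g, ?_, hg0, hgβ.trans ?_⟩
  · rw [idealN_eq_span]
    refine Ideal.subset_span ⟨hg, ?_⟩
    rw [degreeOf_eq_degree_apply hy]
    have := hgβ y
    simpa using this
  · intro i
    by_cases hiy : i = y
    · subst hiy; simp
    · rw [Finsupp.erase_ne hiy]

end FreeOfVariables

/-! ### The lexicographic order with one variable moved to the front. -/

section LexFirst

variable {n : ℕ}

/-- The linear order on `Fin n` that puts `k` before all other indices. -/
abbrev linearOrderFirst (k : Fin n) : LinearOrder (Fin n) :=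
  -- The flag is `false` only at `k`, and `false < true`; thus `k` comes first and the other indices
  -- keep their order.
  LinearOrder.lift' (fun i => (toLex (decide (i ≠ k), i) : Bool ×ₗ Fin n))
    fun _ _ h => congrArg (fun x => (ofLex x).2) h

/-- The lexicographic order in which the variable `k` comes first. -/
def lexFirst (k : Fin n) : MonomialOrder (Fin n) :=
  @MonomialOrder.lex (Fin n) (linearOrderFirst k)
    (@Finite.to_wellFoundedGT (Fin n) _ (linearOrderFirst k).toPreorder)

theorem lexFirst_lt_iff (k : Fin n) (a b : Fin n →₀ ℕ) :
    a ≺[lexFirst k] b ↔ ∃ i, (∀ j, (toLex (decide (j ≠ k), j) : Bool ×ₗ Fin n) <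
      toLex (decide (i ≠ k), i) → a j = b j) ∧ a i < b i := Iff.rfl

theorem lex_lt_iff_exists (a b : Fin n →₀ ℕ) :
    a ≺[MonomialOrder.lex] b ↔ ∃ i, (∀ j, j < i → a j = b j) ∧ a i < b i := Iff.rfl

theorem lexFirst_lt_of_apply_lt (k : Fin n) (a b : Fin n →₀ ℕ) (h : a k < b k) :
    a ≺[lexFirst k] b := by
  rw [lexFirst_lt_iff]
  refine ⟨k, fun j hj => ?_, h⟩
  by_cases hjk : j = k
  · simp [hjk] at hj
  · simp only [hjk, Prod.Lex.toLex_lt_toLex, ne_eq, not_false_eq_true, decide_true,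
      not_true_eq_false, decide_false, Bool.true_eq_false, false_and, or_false] at hj
    exact absurd hj (by decide)

/-- The two orders differ only in placing `k` before the smaller indices, where both exponents
vanish. -/
theorem agreeOff_lex_lexFirst (k : Fin n) :
    AgreeOff {i | i < k} MonomialOrder.lex (lexFirst k) := by
  intro a b ha hb
  rw [← not_lt, ← not_lt, not_iff_not, lexFirst_lt_iff, lex_lt_iff_exists]
  simp only [Set.mem_ofPred_eq] at ha hb
  refine exists_congr fun i => ?_
  rw [and_congr_left_iff]
  intro hlt
  have hik : k ≤ i := not_lt.1 fun h => by simp [ha i h] at hlt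
  refine forall_congr' fun j => ?_
  by_cases hj : j < k
  · simp [ha j hj, hb j hj]
  · obtain rfl | hlt' := (not_lt.1 hj).eq_or_lt
    · by_cases hij : i = k
      · simp [hij]
      · have : k < i := lt_of_le_of_ne hik (Ne.symm hij)
        simp [Prod.Lex.toLex_lt_toLex, this, hij]
    · have h1 : j ≠ k := hlt'.ne'
      by_cases hij : i = k
      · simp [Prod.Lex.toLex_lt_toLex, hij, h1, hlt'.le]
      · simp [Prod.Lex.toLex_lt_toLex, hij, h1]

end LexFirst

/-! ### Minimal pairs with equal image, and Groebner bases of toric ideals. -/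

section MinimalPairs

variable {ι M : Type*} [AddCommMonoid M]

/-- `(a, b)` is a minimal pair of distinct exponents with the same value under `A`. -/
def IsMinimalPair (A : (ι →₀ ℕ) →+ M) (a b : ι →₀ ℕ) : Prop :=
  a ≠ b ∧ A a = A b ∧ ∀ c d : ι →₀ ℕ, c ≠ d → A c = A d → c ≤ a → d ≤ b → c = a ∧ d = b

theorem IsMinimalPair.symm {A : (ι →₀ ℕ) →+ M} {a b : ι →₀ ℕ} (h : IsMinimalPair A a b) :
    IsMinimalPair A b a :=
  ⟨h.1.symm, h.2.1.symm, fun c d hne hA hc hd => (h.2.2 d c hne.symm hA.symm hd hc).symm⟩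

/-- A variable common to both sides could be cancelled, leaving a smaller pair. -/
theorem IsMinimalPair.eq_zero_or_eq_zero [IsCancelAdd M] {A : (ι →₀ ℕ) →+ M} {a b : ι →₀ ℕ}
    (h : IsMinimalPair A a b) (i : ι) : a i = 0 ∨ b i = 0 := by
  by_contra! hi
  have ha : Finsupp.single i 1 ≤ a := by
    rw [Finsupp.single_le_iff]; exact Nat.one_le_iff_ne_zero.2 hi.1
  have hb : Finsupp.single i 1 ≤ b := by
    rw [Finsupp.single_le_iff]; exact Nat.one_le_iff_ne_zero.2 hi.2
  have h1 := tsub_add_cancel_of_le ha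
  have h2 := tsub_add_cancel_of_le hb
  have hne : a - Finsupp.single i 1 ≠ b - Finsupp.single i 1 := fun heq =>
    h.1 (by rw [← h1, ← h2, heq])
  have hA : A (a - Finsupp.single i 1) = A (b - Finsupp.single i 1) := by
    apply add_right_cancel (b := A (Finsupp.single i 1))
    rw [← map_add, ← map_add, h1, h2, h.2.1]
  have := DFunLike.congr_fun (h.2.2 _ _ hne hA tsub_le_self tsub_le_self).1 i
  simp only [Finsupp.coe_tsub, Pi.sub_apply, Finsupp.single_eq_same] at this
  omega

/-- Dickson's lemma: minimal pairs form an antichain for the componentwise order. -/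
theorem finite_isMinimalPair [Finite ι] (A : (ι →₀ ℕ) →+ M) :
    {p : (ι →₀ ℕ) × (ι →₀ ℕ) | IsMinimalPair A p.1 p.2}.Finite := by
  apply WellQuasiOrderedLE.finite_of_isAntichain
  intro p hp q hq hne hle
  obtain ⟨h1, h2⟩ := hq.2.2 p.1 p.2 hp.1 hp.2.1 hle.1 hle.2
  exact hne (Prod.ext h1 h2)

/-- Choose a pair minimal among those with the prescribed orientation. It is minimal among all
pairs, because the complement of a smaller pair of the wrong orientation is correctly oriented. -/
theorem exists_isMinimalPair_le [Finite ι] [IsCancelAdd M] (m : MonomialOrder ι) (A : (ι →₀ ℕ) →+ M)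
    {a b : ι →₀ ℕ} (hA : A a = A b) (hlt : b ≺[m] a) :
    ∃ c d, IsMinimalPair A c d ∧ d ≺[m] c ∧ c ≤ a ∧ d ≤ b := by
  set s : Set ((ι →₀ ℕ) × (ι →₀ ℕ)) :=
    {p | A p.1 = A p.2 ∧ p.2 ≺[m] p.1 ∧ p.1 ≤ a ∧ p.2 ≤ b}
  have hs : s.Nonempty := ⟨(a, b), hA, hlt, le_rfl, le_rfl⟩
  obtain ⟨p, hp, hmin⟩ := (wellFounded_lt (α := (ι →₀ ℕ) × (ι →₀ ℕ))).has_min s hs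
  have hmin' : ∀ q ∈ s, q ≤ p → q = p := fun q hq hle =>
    hle.eq_or_lt.resolve_right (hmin q hq)
  refine ⟨p.1, p.2, ⟨?_, hp.1, ?_⟩, hp.2⟩
  · intro h
    have := hp.2.1
    rw [h] at this
    exact lt_irrefl _ this
  intro c d hne hcd hc hd
  have hsub : ∀ c d : ι →₀ ℕ, c ≤ p.1 → d ≤ p.2 → A c = A d → d ≺[m] c →
      c = p.1 ∧ d = p.2 := fun c d hc hd hcd hlt =>
    Prod.ext_iff.1 (hmin' (c, d) ⟨hcd, hlt, hc.trans hp.2.2.1, hd.trans hp.2.2.2⟩ ⟨hc, hd⟩)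
  obtain h | h | h := lt_trichotomy (m.toSyn c) (m.toSyn d)
  -- The complement `(p.1 - c, p.2 - d)` must be all of `p`, which forces `c = d = 0`.
  · have h1 := tsub_add_cancel_of_le hc
    have h2 := tsub_add_cancel_of_le hd
    have hA' : A (p.1 - c) = A (p.2 - d) := by
      apply add_right_cancel (b := A c)
      rw [← map_add, h1, hcd, ← map_add, h2, hp.1]
    have hlt' : p.2 - d ≺[m] p.1 - c := by
      by_contra hle
      have h3 := add_lt_add_of_le_of_lt (not_lt.1 hle) h
      rw [← map_add, ← map_add, h1, h2] at h3
      exact lt_asymm h3 hp.2.1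
    obtain ⟨h3, h4⟩ := hsub _ _ tsub_le_self tsub_le_self hA' hlt'
    have hc0 : c = 0 := by
      rw [h3] at h1
      exact left_eq_add.1 h1.symm
    have hd0 : d = 0 := by
      rw [h4] at h2
      exact left_eq_add.1 h2.symm
    exact absurd (hc0.trans hd0.symm) hne
  · exact absurd (m.toSyn.injective h) hne
  · exact hsub c d hc hd hcd h

variable {K σ : Type*} [Field K]

/-- The minimal pairs give a Groebner basis of a toric ideal for every monomial order. -/
theorem leadsIdeal_minimalPairs [Finite ι] (m : MonomialOrder ι) (A : (ι →₀ ℕ) →+ (σ →₀ ℕ))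
    (φ : MvPolynomial ι K →ₐ[K] MvPolynomial σ K)
    (hφ : ∀ a c, φ (monomial a c) = monomial (A a) c) :
    LeadsIdeal m {p | ∃ a b, p = monomial a (1 : K) - monomial b 1 ∧ IsMinimalPair A a b}
      (RingHom.ker φ) := by
  classical
  refine ⟨?_, fun f hf hf0 => ?_⟩
  · rintro _ ⟨a, b, rfl, h⟩
    simp [RingHom.mem_ker, hφ, h.2.1]
  -- The image of the leading term has to cancel against that of another term of `f`, whose exponent
  -- therefore has the same value under `A`.
  have h0 : (φ f).coeff (A (m.degree f)) = 0 := by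
    rw [(RingHom.mem_ker).1 hf, coeff_zero]
  have hφf : φ f = ∑ v ∈ f.support, φ (monomial v (f.coeff v)) := by
    conv_lhs => rw [f.as_sum, map_sum]
  rw [hφf, coeff_sum] at h0
  simp only [hφ, coeff_monomial] at h0
  obtain ⟨b, hb, hbne, hbA⟩ : ∃ b ∈ f.support, b ≠ m.degree f ∧ A b = A (m.degree f) := by
    by_contra! hcon
    rw [Finset.sum_eq_single_of_mem (m.degree f) (m.degree_mem_support hf0)] at h0
    · rw [if_pos rfl] at h0
      exact m.coeff_degree_ne_zero_iff.2 hf0 h0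
    · intro b hb hne
      rw [if_neg (hcon b hb hne)]
  have hlt : b ≺[m] m.degree f :=
    lt_of_le_of_ne (m.le_degree hb) fun h => hbne (m.toSyn.injective h)
  obtain ⟨c, d, hcd, hdc, hc, -⟩ := exists_isMinimalPair_le m A hbA.symm hlt
  have hne : c ≠ d := hcd.1
  have hcoeff : (monomial c (1 : K) - monomial d 1).coeff c = 1 := by
    simp [coeff_sub, coeff_monomial, hne.symm]
  refine ⟨_, ⟨c, d, rfl, hcd⟩, fun h => by simp [h] at hcoeff, ?_⟩
  rw [degree_eq_of_forall_le (a := c) (by simp [hcoeff])]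
  · exact hc
  · intro b hb
    simp only [coeff_sub, coeff_monomial] at hb
    by_cases h1 : c = b
    · rw [h1]
    by_cases h2 : d = b
    · rw [← h2]; exact hdc.le
    simp [h1, h2] at hb

end MinimalPairs

/-! ### Toric ideals of graphs and closed even walks. -/

section Graph

variable {V ι : Type*} (H : SimpleGraph V) (e : ι ≃ H.edgeSet)

/-- The exponent `single u 1 + single v 1` of the pair `{u, v}`. -/
def endpointVector : Sym2 V → (V →₀ ℕ) :=
  Sym2.lift ⟨fun u v => Finsupp.single u 1 + Finsupp.single v 1, fun _ _ => add_comm _ _⟩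

@[simp]
theorem endpointVector_mk (u v : V) :
    endpointVector s(u, v) = Finsupp.single u 1 + Finsupp.single v 1 := rfl

/-- The vector of vertex degrees of a multiset of edges. -/
def vertexDegree : (ι →₀ ℕ) →+ (V →₀ ℕ) :=
  (Finsupp.linearCombination ℕ fun i => endpointVector (e i : Sym2 V)).toAddMonoidHom

theorem vertexDegree_single (i : ι) (k : ℕ) :
    vertexDegree H e (Finsupp.single i k) = k • endpointVector (e i : Sym2 V) := by
  simp [vertexDegree, Finsupp.linearCombination_single]

theorem edgeMap_monomial (K : Type*) [Field K] (a : ι →₀ ℕ) (c : K) :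
    edgeMap K H e (monomial a c) = monomial (vertexDegree H e a) c := by
  have hX : ∀ i, edgeMap K H e (X i) = monomial (endpointVector (e i : Sym2 V)) 1 := by
    intro i
    rw [edgeMap, aeval_X]
    generalize (e i : Sym2 V) = z
    induction z with
    | _ u v => simp [X, monomial_mul]
  induction a using Finsupp.induction_linear generalizing c with
  | zero => simp [← C_apply, edgeMap]
  | add a b ha hb =>
    have : (monomial (a + b) c : MvPolynomial ι K) = monomial a c * monomial b 1 := by
      rw [monomial_mul, mul_one]
    rw [this, map_mul, ha, hb, monomial_mul, mul_one, map_add]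
  | single i k =>
    have : (monomial (Finsupp.single i k) c : MvPolynomial ι K) = C c * X i ^ k := by
      rw [X_pow_eq_monomial, C_mul_monomial, mul_one]
    rw [this, map_mul, map_pow, hX, monomial_pow, one_pow, vertexDegree_single]
    simp [edgeMap, algebraMap_eq, C_mul_monomial]

theorem binomial_mem_toricIdeal_iff (K : Type*) [Field K] (a b : ι →₀ ℕ) :
    monomial a (1 : K) - monomial b 1 ∈ toricIdeal K H e ↔
      vertexDegree H e a = vertexDegree H e b := by
  rw [toricIdeal, RingHom.mem_ker, map_sub, edgeMap_monomial, edgeMap_monomial, sub_eq_zero]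
  exact (monomial_left_injective (one_ne_zero' K)).eq_iff

theorem isPrimitivePair_iff (K : Type*) [Field K] (a b : ι →₀ ℕ) :
    IsPrimitivePair K H e a b ↔ IsMinimalPair (vertexDegree H e) a b := by
  simp only [IsPrimitivePair, IsMinimalPair, binomial_mem_toricIdeal_iff]

/-- Supplies the next edge when a walk inside a minimal pair is extended: the unused part `a - c`
has positive degree at `w`. -/
theorem exists_mem_of_lt_vertexDegree {a c : ι →₀ ℕ} (hle : c ≤ a) {w : V}
    (h : vertexDegree H e c w < vertexDegree H e a w) :
    ∃ i, c + Finsupp.single i 1 ≤ a ∧ w ∈ (e i : Sym2 V) := by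
  classical
  rw [← add_tsub_cancel_of_le hle, map_add, Finsupp.add_apply] at h
  have hpos : vertexDegree H e (a - c) w ≠ 0 := by omega
  have hsum : vertexDegree H e (a - c) w =
      ∑ i ∈ (a - c).support, (a - c) i * endpointVector (e i : Sym2 V) w := by
    simp [vertexDegree, Finsupp.linearCombination_apply, Finsupp.sum, Finsupp.finsetSum_apply]
  rw [hsum] at hpos
  obtain ⟨i, hi, hne⟩ := Finset.exists_ne_zero_of_sum_ne_zero hpos
  refine ⟨i, ?_, ?_⟩
  · have h1 : Finsupp.single i 1 ≤ a - c := by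
      rw [Finsupp.single_le_iff]
      exact Nat.one_le_iff_ne_zero.2 (Finsupp.mem_support_iff.1 hi)
    calc c + Finsupp.single i 1 ≤ c + (a - c) := by gcongr
      _ = a := add_tsub_cancel_of_le hle
  · have h2 := right_ne_zero_of_mul hne
    generalize (e i : Sym2 V) = z at h2
    induction z with
    | _ u v =>
      rw [Sym2.mem_iff]
      by_contra! hw
      simp [hw.1.symm, hw.2.symm] at h2

/-- Each interior passage through a vertex uses one odd and one even edge, so only the two ends are
unbalanced. -/
theorem vertexDegree_alternatingExponents {u v : V} (p : H.Walk u v) (L : List ι)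
    (hL : p.edges = L.map fun i => (e i : Sym2 V)) :
    (Even L.length → vertexDegree H e (alternatingExponents L).1 + Finsupp.single v 1 =
      vertexDegree H e (alternatingExponents L).2 + Finsupp.single u 1) ∧
    (¬ Even L.length → vertexDegree H e (alternatingExponents L).1 =
      vertexDegree H e (alternatingExponents L).2 + Finsupp.single u 1 + Finsupp.single v 1) := by
  induction p generalizing L with
  | nil =>
    obtain rfl : L = [] := by simpa using hL.symm
    simp [alternatingExponents]
  | @cons u w v huw p ih =>
    obtain _ | ⟨i, L⟩ := L
    · simp at hL
    simp only [SimpleGraph.Walk.edges_cons, List.map_cons, List.cons.injEq] at hL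
    have hd : vertexDegree H e (Finsupp.single i 1) =
        Finsupp.single u 1 + Finsupp.single w 1 := by
      rw [vertexDegree_single, one_smul, ← hL.1, endpointVector_mk]
    obtain ⟨h1, h2⟩ := ih L hL.2
    simp only [List.length_cons, Nat.even_add_one, alternatingExponents, map_add, hd, not_not]
    refine ⟨fun h => ?_, fun h => ?_⟩
    · rw [h2 h]; abel
    · have := h1 h
      rw [add_assoc, add_comm (Finsupp.single w 1), ← this]; abel

theorem degree_alternatingExponents (L : List ι) :
    (alternatingExponents L).1.degree + (alternatingExponents L).2.degree = L.length := by
  induction L with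
  | nil => simp [alternatingExponents]
  | cons i L ih =>
    simp only [alternatingExponents, map_add, Finsupp.degree_single, List.length_cons, ← ih]
    abel

/-- Villarreal: the exponents of a primitive binomial come from a closed even walk. -/
theorem IsMinimalPair.isClosedEvenWalkPair {a b : ι →₀ ℕ}
    (h : IsMinimalPair (vertexDegree H e) a b) : IsClosedEvenWalkPair H e a b := by
  classical
  by_contra hcon
  have hAw : ∀ w, vertexDegree H e a w = vertexDegree H e b w := fun w => by rw [h.2.1]
  -- The odd edges have a surplus at the start `u`, while `x` and `y` have equal degrees there; so
  -- `y` has an unused edge at `u`. Prepending it exchanges odd and even positions.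
  have hcross : ∀ {u v : V} (p : H.Walk u v) (L : List ι) (x y : ι →₀ ℕ),
      p.edges = L.map (fun i => (e i : Sym2 V)) → (∀ w, vertexDegree H e x w = vertexDegree H e y w) →
      (alternatingExponents L).1 ≤ x → (alternatingExponents L).2 ≤ y →
      (Even L.length → u ≠ v) →
      ∃ (u' : V) (q : H.Walk u' v) (i : ι), q.edges = (i :: L).map (fun i => (e i : Sym2 V)) ∧
        (alternatingExponents (i :: L)).1 ≤ y ∧ (alternatingExponents (i :: L)).2 ≤ x := by
    intro u v p L x y hL hxy hx hy hne
    have hlt : vertexDegree H e (alternatingExponents L).2 u < vertexDegree H e y u := by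
      have hle : vertexDegree H e (alternatingExponents L).1 u ≤ vertexDegree H e x u := by
        rw [← add_tsub_cancel_of_le hx, map_add, Finsupp.add_apply]
        exact Nat.le_add_right _ _
      rw [← hxy u]
      refine lt_of_lt_of_le ?_ hle
      obtain ⟨h1, h2⟩ := vertexDegree_alternatingExponents H e p L hL
      by_cases hev : Even L.length
      · have := DFunLike.congr_fun (h1 hev) u
        simp only [Finsupp.add_apply, Finsupp.single_eq_same,
          Finsupp.single_eq_of_ne (hne hev)] at this
        omega
      · have := DFunLike.congr_fun (h2 hev) u
        simp only [Finsupp.add_apply, Finsupp.single_eq_same] at this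
        omega
    obtain ⟨i, hi, hmem⟩ := exists_mem_of_lt_vertexDegree H e hy hlt
    obtain ⟨u', hu'⟩ := Sym2.mem_iff_exists.1 hmem
    have hadj : H.Adj u' u := by
      have := (e i).2
      rw [hu', SimpleGraph.mem_edgeSet] at this
      exact this.symm
    refine ⟨u', SimpleGraph.Walk.cons hadj p, i, ?_, ?_, hx⟩
    · rw [SimpleGraph.Walk.edges_cons, List.map_cons, hL, hu', Sym2.eq_swap]
    · rw [add_comm] at hi
      exact hi
  -- Without a closed even walk for `(a, b)` the extension never stops. The parity of the length
  -- records which of `a` and `b` bounds the odd positions.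
  have hlong : ∀ N : ℕ, ∃ (u v : V) (p : H.Walk u v) (L : List ι),
      p.edges = L.map (fun i => (e i : Sym2 V)) ∧ L.length = N + 1 ∧
      (Even L.length → (alternatingExponents L).1 ≤ a ∧ (alternatingExponents L).2 ≤ b) ∧
      (¬ Even L.length → (alternatingExponents L).1 ≤ b ∧ (alternatingExponents L).2 ≤ a) := by
    intro N
    induction N with
    | zero =>
      obtain ⟨i, hi⟩ : ∃ i, b i ≠ 0 := by
        by_contra! hb
        have hb0 : b = 0 := Finsupp.ext hb
        obtain ⟨i, hi⟩ := Finsupp.ne_iff.1 (hb0 ▸ h.1)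
        have hle : Finsupp.single i 1 ≤ a := by
          rw [Finsupp.single_le_iff]
          exact Nat.one_le_iff_ne_zero.2 hi
        have h1 := h.2.1
        rw [hb0, map_zero, ← add_tsub_cancel_of_le hle, map_add, vertexDegree_single, one_smul,
          add_eq_zero] at h1
        have h2 := h1.1
        generalize (e i : Sym2 V) = z at h2
        induction z with
        | _ u v => simpa using DFunLike.congr_fun h2 u
      obtain ⟨u, v, huv⟩ : ∃ u v, (e i : Sym2 V) = s(u, v) :=
        ⟨_, _, (Quot.out_eq (e i : Sym2 V)).symm⟩
      have hadj : H.Adj u v := by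
        have := (e i).2
        rwa [huv, SimpleGraph.mem_edgeSet] at this
      refine ⟨u, v, hadj.toWalk, [i], by simp [huv], rfl, by simp, fun _ => ⟨?_, ?_⟩⟩
      · simp only [alternatingExponents, add_zero]
        rw [Finsupp.single_le_iff]
        exact Nat.one_le_iff_ne_zero.2 hi
      · simp [alternatingExponents]
    | succ N ih =>
      obtain ⟨u, v, p, L, hL, hlen, hE, hO⟩ := ih
      by_cases hev : Even L.length
      · have hne : u ≠ v := by
          rintro rfl
          apply hcon
          refine ⟨u, p, L, ?_, hL, ?_⟩
          · rw [← SimpleGraph.Walk.length_edges, hL, List.length_map]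
            exact hev
          · have hA := (vertexDegree_alternatingExponents H e p L hL).1 hev
            have hA' := add_right_cancel hA
            -- Equal exponents would lie below both `a` and `b`, whose supports are disjoint, so the
            -- walk would be empty.
            have hcd : (alternatingExponents L).1 ≠ (alternatingExponents L).2 := by
              intro heq
              have hz : (alternatingExponents L).1 = 0 := by
                ext i
                have h1 := (hE hev).1 i
                have h2 := (hE hev).2 i
                rw [← heq] at h2
                have := h.eq_zero_or_eq_zero i
                simp only [Finsupp.coe_zero, Pi.zero_apply]
                omega
              have hdeg := degree_alternatingExponents L
              rw [← heq, hz, hlen, map_zero] at hdeg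
              omega
            obtain ⟨h1, h2⟩ := h.2.2 _ _ hcd hA' (hE hev).1 (hE hev).2
            exact Prod.ext h1 h2
        obtain ⟨u', q, i, hq, hy, hx⟩ :=
          hcross p L a b hL hAw (hE hev).1 (hE hev).2 fun _ => hne
        have hnev : ¬ Even (i :: L).length := by
          rw [List.length_cons, Nat.even_add_one]; exact not_not.2 hev
        exact ⟨u', v, q, i :: L, hq, by simp [hlen], fun h => absurd h hnev, fun _ => ⟨hy, hx⟩⟩
      · obtain ⟨u', q, i, hq, hy, hx⟩ :=
          hcross p L b a hL (fun w => (hAw w).symm) (hO hev).1 (hO hev).2 fun h => absurd h hev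
        have hev' : Even (i :: L).length := by
          rw [List.length_cons, Nat.even_add_one]; exact hev
        exact ⟨u', v, q, i :: L, hq, by simp [hlen], fun _ => ⟨hy, hx⟩, fun h => absurd hev' h⟩
  -- A walk with one edge more than `a` and `b` provide together.
  obtain ⟨u, v, p, L, -, hlen, hE, hO⟩ := hlong (a.degree + b.degree)
  have hdeg := degree_alternatingExponents L
  by_cases hev : Even L.length
  · have h1 := Finsupp.degree_mono (hE hev).1
    have h2 := Finsupp.degree_mono (hE hev).2
    omega
  · have h1 := Finsupp.degree_mono (hO hev).1
    have h2 := Finsupp.degree_mono (hO hev).2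
    omega

theorem primitiveWalkBinomials_eq (K : Type*) [Field K] :
    primitiveWalkBinomials K H e =
      {p | ∃ a b, p = monomial a 1 - monomial b 1 ∧ IsMinimalPair (vertexDegree H e) a b} := by
  ext p
  simp only [primitiveWalkBinomials, Set.mem_ofPred_eq, isPrimitivePair_iff]
  refine exists_congr fun a => exists_congr fun b => and_congr_right fun _ => ?_
  exact ⟨fun h => h.1, fun h => ⟨h, h.isClosedEvenWalkPair⟩⟩

theorem leadsIdeal_primitiveWalkBinomials [Finite ι] (K : Type*) [Field K]
    (m : MonomialOrder ι) :
    LeadsIdeal m (primitiveWalkBinomials K H e) (toricIdeal K H e) := by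
  rw [primitiveWalkBinomials_eq]
  exact leadsIdeal_minimalPairs m _ _ (edgeMap_monomial H e K)

end Graph

/-! ### Deleting edges. -/

section Deletion

variable {V ι : Type*} (G : SimpleGraph V) (e : ι ≃ G.edgeSet) (S : Set ι)

theorem vertexDegree_delete (a : {i // i ∉ S} →₀ ℕ) :
    vertexDegree (deleteLabels G e S) (deleteLabelling G e S) a =
      vertexDegree G e (a.mapDomain Subtype.val) := by
  simp only [vertexDegree, LinearMap.toAddMonoidHom_coe, Finsupp.linearCombination_mapDomain]
  rfl

theorem exists_eq_mapDomain {a : ι →₀ ℕ} (ha : ∀ i ∈ S, a i = 0) :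
    ∃ c : {i // i ∉ S} →₀ ℕ, c.mapDomain Subtype.val = a := by
  refine ⟨a.comapDomain Subtype.val Subtype.val_injective.injOn, ?_⟩
  refine Finsupp.mapDomain_comapDomain _ Subtype.val_injective _ fun i hi => ?_
  exact ⟨⟨i, fun hS => Finsupp.mem_support_iff.1 hi (ha i hS)⟩, rfl⟩

theorem mapDomain_val_apply_of_mem (a : {i // i ∉ S} →₀ ℕ) {i : ι} (hi : i ∈ S) :
    a.mapDomain Subtype.val i = 0 := by
  refine Finsupp.mapDomain_of_notMem_range _ _ ?_
  rintro ⟨j, rfl⟩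
  exact j.2 hi

theorem mapDomain_val_le_iff (a b : {i // i ∉ S} →₀ ℕ) :
    a.mapDomain Subtype.val ≤ b.mapDomain Subtype.val ↔ a ≤ b := by
  constructor
  · intro h i
    have := h i.1
    rwa [Finsupp.mapDomain_apply Subtype.val_injective,
      Finsupp.mapDomain_apply Subtype.val_injective] at this
  · intro h i
    by_cases hi : i ∈ S
    · rw [mapDomain_val_apply_of_mem S a hi]; exact Nat.zero_le _
    · have := h ⟨i, hi⟩
      rwa [← Finsupp.mapDomain_apply Subtype.val_injective a,
        ← Finsupp.mapDomain_apply Subtype.val_injective b] at this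

/-- Every exponent below an `S`-free one is `S`-free, so deletion adds and removes no competitors
for minimality. -/
theorem isMinimalPair_delete_iff (a b : {i // i ∉ S} →₀ ℕ) :
    IsMinimalPair (vertexDegree (deleteLabels G e S) (deleteLabelling G e S)) a b ↔
      IsMinimalPair (vertexDegree G e) (a.mapDomain Subtype.val) (b.mapDomain Subtype.val) := by
  have hinj : Function.Injective
      (Finsupp.mapDomain (M := ℕ) (Subtype.val : {i // i ∉ S} → ι)) :=
    Finsupp.mapDomain_injective Subtype.val_injective
  simp only [IsMinimalPair, vertexDegree_delete, ne_eq, hinj.eq_iff]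
  refine and_congr_right fun _ => and_congr_right fun _ => ?_
  constructor
  · intro h c d hne hA hc hd
    obtain ⟨c, rfl⟩ := exists_eq_mapDomain S (a := c) fun i hi =>
      Nat.le_zero.1 ((hc i).trans (mapDomain_val_apply_of_mem S a hi).le)
    obtain ⟨d, rfl⟩ := exists_eq_mapDomain S (a := d) fun i hi =>
      Nat.le_zero.1 ((hd i).trans (mapDomain_val_apply_of_mem S b hi).le)
    obtain ⟨h1, h2⟩ := h c d (fun h => hne (by rw [h])) hA ((mapDomain_val_le_iff S _ _).1 hc)
      ((mapDomain_val_le_iff S _ _).1 hd)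
    exact ⟨by rw [h1], by rw [h2]⟩
  · intro h c d hne hA hc hd
    obtain ⟨h1, h2⟩ := h _ _ (fun h => hne (hinj h)) hA ((mapDomain_val_le_iff S _ _).2 hc)
      ((mapDomain_val_le_iff S _ _).2 hd)
    exact ⟨hinj h1, hinj h2⟩

theorem primitiveWalkBinomialsDelete_eq (K : Type*) [Field K] :
    primitiveWalkBinomialsDelete K G e S =
      {p | ∃ a b, p = monomial a 1 - monomial b 1 ∧ IsMinimalPair (vertexDegree G e) a b ∧
        (∀ i ∈ S, a i = 0) ∧ ∀ i ∈ S, b i = 0} := by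
  rw [primitiveWalkBinomialsDelete, primitiveWalkBinomials_eq]
  ext p
  constructor
  · rintro ⟨_, ⟨a, b, rfl, h⟩, rfl⟩
    refine ⟨_, _, ?_, (isMinimalPair_delete_iff G e S a b).1 h,
      fun i hi => mapDomain_val_apply_of_mem S a hi, fun i hi => mapDomain_val_apply_of_mem S b hi⟩
    rw [map_sub, rename_monomial, rename_monomial]
  · rintro ⟨a, b, rfl, h, ha, hb⟩
    obtain ⟨a, rfl⟩ := exists_eq_mapDomain S ha
    obtain ⟨b, rfl⟩ := exists_eq_mapDomain S hb
    refine ⟨_, ⟨a, b, rfl, (isMinimalPair_delete_iff G e S a b).2 h⟩, ?_⟩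
    rw [map_sub, rename_monomial, rename_monomial]

theorem toricIdealDelete_eq_span [Finite ι] [LinearOrder ι] (K : Type*) [Field K] :
    toricIdealDelete K G e S = Ideal.span (primitiveWalkBinomialsDelete K G e S) := by
  rw [toricIdealDelete, ← (leadsIdeal_primitiveWalkBinomials _ _ K MonomialOrder.lex).span_eq,
    Ideal.map_span]
  rfl

end Deletion

/-! ### Pure difference binomials: leading terms and initial forms. -/

section Binomials

variable {σ K : Type*} [Field K]

theorem coeff_monomial_sub_left {a b : σ →₀ ℕ} (h : a ≠ b) :
    (monomial a (1 : K) - monomial b 1).coeff a = 1 := by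
  classical simp [coeff_monomial, h.symm]

theorem coeff_monomial_sub_right {a b : σ →₀ ℕ} (h : a ≠ b) :
    (monomial a (1 : K) - monomial b 1).coeff b = -1 := by
  classical simp [coeff_monomial, h]

theorem eq_or_eq_of_coeff_monomial_sub_ne_zero {a b c : σ →₀ ℕ}
    (h : (monomial a (1 : K) - monomial b 1).coeff c ≠ 0) : c = a ∨ c = b := by
  classical
  by_contra! hc
  simp [coeff_monomial, hc.1.symm, hc.2.symm] at h

theorem degree_monomial_sub {m : MonomialOrder σ} {a b : σ →₀ ℕ} (h : b ≺[m] a) :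
    m.degree (monomial a (1 : K) - monomial b 1) = a := by
  have hne : a ≠ b := by rintro rfl; exact lt_irrefl _ h
  refine degree_eq_of_forall_le (by simp [coeff_monomial_sub_left hne]) fun c hc => ?_
  obtain rfl | rfl := eq_or_eq_of_coeff_monomial_sub_ne_zero hc
  · exact le_rfl
  · exact h.le

theorem leadingTerm_monomial_sub_iff (m : MonomialOrder σ) {a b : σ →₀ ℕ} (hne : a ≠ b) :
    m.leadingTerm (monomial a (1 : K) - monomial b 1) = monomial a 1 ↔ b ≺[m] a := by
  classical
  constructor
  · intro h
    have hd : m.degree (monomial a (1 : K) - monomial b 1) = a := by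
      rw [← m.degree_leadingTerm, h, m.degree_monomial, if_neg one_ne_zero]
    have hb := m.le_degree (f := monomial a (1 : K) - monomial b 1) (d := b)
      (mem_support_iff.2 (by simp [coeff_monomial_sub_right hne]))
    rw [hd] at hb
    exact lt_of_le_of_ne hb fun h => hne (m.toSyn.injective h).symm
  · intro h
    rw [MonomialOrder.leadingTerm, MonomialOrder.leadingCoeff, degree_monomial_sub h,
      coeff_monomial_sub_left hne]

/-- The signs distinguish the two monomials because `1 ≠ -1`; in characteristic two they could be
exchanged. -/
theorem monomial_sub_eq_iff [CharZero K] {a b c d : σ →₀ ℕ} (hcd : c ≠ d) :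
    monomial a (1 : K) - monomial b 1 = monomial c 1 - monomial d 1 ↔ a = c ∧ b = d := by
  classical
  refine ⟨fun h => ?_, fun h => by rw [h.1, h.2]⟩
  have h1 := congrArg (coeff c) h
  have h2 := congrArg (coeff d) h
  rw [coeff_monomial_sub_left hcd] at h1
  rw [coeff_monomial_sub_right hcd] at h2
  simp only [coeff_sub, coeff_monomial] at h1 h2
  constructor
  · by_contra hac
    rw [if_neg hac] at h1
    split_ifs at h1 <;> norm_num at h1
  · by_contra hbd
    rw [if_neg hbd] at h2
    split_ifs at h2 <;> norm_num at h2

theorem freeOf_monomial {S : Set σ} {a : σ →₀ ℕ} (h : ∀ i ∈ S, a i = 0) (c : K) :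
    FreeOf S (monomial a c) := by
  classical
  intro b hb
  rw [coeff_monomial] at hb
  obtain rfl : a = b := by by_contra hne; simp [hne] at hb
  exact h

theorem freeOf_monomial_sub {S : Set σ} {a b : σ →₀ ℕ} (ha : ∀ i ∈ S, a i = 0)
    (hb : ∀ i ∈ S, b i = 0) : FreeOf S (monomial a (1 : K) - monomial b 1) := by
  intro c hc
  obtain rfl | rfl := eq_or_eq_of_coeff_monomial_sub_ne_zero hc
  · exact ha
  · exact hb

theorem degreeOf_monomial_one (y : σ) (a : σ →₀ ℕ) : (monomial a (1 : K)).degreeOf y = a y := by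
  rw [degreeOf_monomial_eq _ _ one_ne_zero]

theorem initialFormCoeff_monomial (y : σ) (a : σ →₀ ℕ) :
    initialFormCoeff y (monomial a (1 : K)) = monomial (a.erase y) 1 := by
  classical
  have : initialForm y (monomial a (1 : K)) = monomial a 1 := by
    ext b
    rw [coeff_initialForm, degreeOf_monomial_one, coeff_monomial]
    by_cases h : a = b <;> simp [h]
  rw [← substOne_initialForm, this, substOne_monomial]

theorem initialFormCoeff_monomial_sub {y : σ} {a b : σ →₀ ℕ} (h : b y < a y) :
    initialFormCoeff y (monomial a (1 : K) - monomial b 1) = monomial (a.erase y) 1 := by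
  classical
  have hne : a ≠ b := by rintro rfl; exact lt_irrefl _ h
  have hd : (monomial a (1 : K) - monomial b 1).degreeOf y = a y := by
    refine le_antisymm (degreeOf_le_iff.2 fun c hc => ?_)
      (monomial_le_degreeOf y (mem_support_iff.2 (by simp [coeff_monomial_sub_left hne])))
    obtain rfl | rfl := eq_or_eq_of_coeff_monomial_sub_ne_zero (mem_support_iff.1 hc)
    · exact le_rfl
    · exact h.le
  have : initialForm y (monomial a (1 : K) - monomial b 1) = monomial a 1 := by
    ext c
    rw [coeff_initialForm, hd, coeff_sub, coeff_monomial, coeff_monomial]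
    by_cases h1 : a = c
    · subst h1; simp [hne.symm]
    · by_cases h2 : b = c
      · subst h2; simp [h1, h.ne]
      · simp [h1, h2]
  rw [← substOne_initialForm, this, substOne_monomial]

theorem initialFormCoeff_neg (y : σ) (f : MvPolynomial σ K) :
    initialFormCoeff y (-f) = -initialFormCoeff y f := by
  have : initialForm y (-f) = -initialForm y f := by
    classical
    ext c
    have hd : (-f).degreeOf y = f.degreeOf y := by simp only [degreeOf_eq_sup, support_neg]
    rw [coeff_neg, coeff_initialForm, coeff_initialForm, coeff_neg, hd]
    split_ifs <;> simp
  rw [← substOne_initialForm, this, map_neg, substOne_initialForm]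

/-- Needed because a binomial with `y` in its second monomial has the negative of a monomial as
coefficient. -/
theorem LeadsIdeal.of_eq_or_eq_neg {m : MonomialOrder σ} {B B' : Set (MvPolynomial σ K)}
    {I : Ideal (MvPolynomial σ K)} (h : LeadsIdeal m B I) (hsub : B' ⊆ B)
    (hneg : ∀ b ∈ B, ∃ b' ∈ B', b = b' ∨ b = -b') : LeadsIdeal m B' I := by
  refine ⟨hsub.trans h.1, fun f hf hf0 => ?_⟩
  obtain ⟨b, hb, hb0, hle⟩ := h.2 f hf hf0
  obtain ⟨b', hb', rfl | rfl⟩ := hneg b hb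
  · exact ⟨b, hb', hb0, hle⟩
  · exact ⟨b', hb', by simpa using hb0, by rwa [m.degree_neg] at hle⟩

end Binomials

/-! ### How the natural generators change when label `k` joins `E` or `F`. -/

section NaturalGenerators

variable {K V : Type*} [Field K] {n : ℕ} {G : SimpleGraph V} {e : Fin n ≃ G.edgeSet}

theorem idealEF_eq_span (G : SimpleGraph V) (e : Fin n ≃ G.edgeSet) (E F : Set (Fin n)) :
    Ideal.span (naturalGenerators K G e E F) = idealEF K G e E F := by
  rw [naturalGenerators, Ideal.span_union, idealEF, toricIdealDelete_eq_span]

theorem mem_monomialGenerators_iff [CharZero K] {E F : Set (Fin n)}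
    {q : MvPolynomial (Fin n) K} :
    q ∈ monomialGenerators K G e E F ↔ ∃ a l b : Fin n →₀ ℕ, q = monomial a 1 ∧
      IsMinimalPair (vertexDegree G e) (a + l) b ∧ b ≺[MonomialOrder.lex] a + l ∧ l ≠ 0 ∧
      (∀ i ∉ E, l i = 0) ∧ (∀ i ∈ F, (a + l) i = 0) ∧ ∀ i ∈ E, a i = 0 := by
  rw [monomialGenerators, primitiveWalkBinomials_eq]
  refine exists_congr fun a => exists_congr fun l => exists_congr fun b =>
    and_congr_right fun _ => ?_
  have h1 : monomial (a + l) (1 : K) - monomial b 1 ∈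
      {p | ∃ a b, p = monomial a (1 : K) - monomial b 1 ∧ IsMinimalPair (vertexDegree G e) a b} ↔
      IsMinimalPair (vertexDegree G e) (a + l) b := by
    constructor
    · rintro ⟨c, d, heq, h⟩
      obtain ⟨rfl, rfl⟩ := (monomial_sub_eq_iff h.1).1 heq
      exact h
    · exact fun h => ⟨_, _, rfl, h⟩
  have h2 : ((l.support : Set (Fin n)) ⊆ E) ↔ ∀ i ∉ E, l i = 0 := by
    refine forall_congr' fun i => ?_
    simp only [Finset.mem_coe, Finsupp.mem_support_iff]
    exact not_imp_comm
  rw [h1, h2]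
  refine and_congr_right fun h => ?_
  rw [leadingTerm_monomial_sub_iff _ h.1]

theorem freeOf_naturalGenerators [CharZero K] {E F : Set (Fin n)} {p : MvPolynomial (Fin n) K}
    (hp : p ∈ naturalGenerators K G e E F) : FreeOf (E ∪ F) p := by
  obtain hp | hp := hp
  · rw [primitiveWalkBinomialsDelete_eq] at hp
    obtain ⟨a, b, rfl, -, ha, hb⟩ := hp
    exact freeOf_monomial_sub ha hb
  · obtain ⟨a, l, b, rfl, -, -, -, -, hF, hE⟩ := mem_monomialGenerators_iff.1 hp
    refine freeOf_monomial (fun i hi => ?_) _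
    obtain hi | hi := hi
    · exact hE i hi
    · have := hF i hi
      rw [Finsupp.add_apply] at this
      omega

theorem finite_naturalGenerators [CharZero K] (E F : Set (Fin n)) :
    (naturalGenerators K G e E F).Finite := by
  classical
  have hfin := finite_isMinimalPair (vertexDegree G e)
  refine Set.Finite.union ?_ ?_
  · rw [primitiveWalkBinomialsDelete_eq]
    refine (hfin.image fun p => monomial p.1 (1 : K) - monomial p.2 1).subset ?_
    rintro _ ⟨a, b, rfl, h, -⟩
    exact ⟨(a, b), h, rfl⟩
  -- The monomial `a` is recovered from `a + l` by discarding the coordinates in `E`.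
  · refine (hfin.image fun p => monomial (Finsupp.filter (fun i => i ∉ E) p.1) (1 : K)).subset ?_
    intro q hq
    obtain ⟨a, l, b, rfl, h, -, -, hl, -, hE⟩ := mem_monomialGenerators_iff.1 hq
    refine ⟨(a + l, b), h, ?_⟩
    have hfilter : Finsupp.filter (fun i => i ∉ E) (a + l) = a := by
      ext i
      by_cases hi : i ∈ E
      · rw [Finsupp.filter_apply, if_neg (not_not.2 hi), hE i hi]
      · rw [Finsupp.filter_apply, if_pos hi, Finsupp.add_apply, hl i hi, add_zero]
    simp only [hfilter]

theorem apply_eq_zero_of_lex_lt {k : Fin n} {a b : Fin n →₀ ℕ} (h : b ≺[MonomialOrder.lex] a)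
    (ha : ∀ i < k, a i = 0) : ∀ i < k, b i = 0 := by
  obtain ⟨j, hj, hlt⟩ := (lex_lt_iff_exists b a).1 h
  have hkj : k ≤ j := not_lt.1 fun h => by rw [ha j h] at hlt; omega
  exact fun i hi => (hj i (hi.trans_le hkj)).trans (ha i hi)

variable {k : Fin n} {E F : Set (Fin n)} (hEF : E ∪ F = {i | i < k})

include hEF

/-- For the monomial generators: `ℓ` involves only `E`, which does not contain `k`, so `k` divides
`mℓ` exactly when it divides `m`. -/
theorem naturalGenerators_filter_eq [CharZero K] :
    {p ∈ naturalGenerators K G e E F | p.degreeOf k = 0} =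
      naturalGenerators K G e E (F ∪ {k}) := by
  have hkE : k ∉ E := fun h => lt_irrefl k (hEF.le (Or.inl h))
  ext p
  constructor
  · rintro ⟨hp | hp, hk⟩
    · left
      rw [primitiveWalkBinomialsDelete_eq] at hp ⊢
      obtain ⟨a, b, rfl, h, ha, hb⟩ := hp
      rw [degreeOf_eq_zero_iff_freeOf] at hk
      have hak := hk a (by simp [coeff_monomial_sub_left h.1]) k rfl
      have hbk := hk b (by simp [coeff_monomial_sub_right h.1]) k rfl
      refine ⟨a, b, rfl, h, ?_, ?_⟩
      · rintro i (hi | hi | rfl)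
        exacts [ha i (Or.inl hi), ha i (Or.inr hi), hak]
      · rintro i (hi | hi | rfl)
        exacts [hb i (Or.inl hi), hb i (Or.inr hi), hbk]
    · right
      rw [mem_monomialGenerators_iff] at hp ⊢
      obtain ⟨a, l, b, rfl, h, hlt, hl0, hl, hF, hE⟩ := hp
      rw [degreeOf_monomial_one] at hk
      refine ⟨a, l, b, rfl, h, hlt, hl0, hl, ?_, hE⟩
      rintro i (hi | rfl)
      · exact hF i hi
      · rw [Finsupp.add_apply, hk, hl i hkE]
  · rintro (hp | hp)
    · rw [primitiveWalkBinomialsDelete_eq] at hp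
      obtain ⟨a, b, rfl, h, ha, hb⟩ := hp
      refine ⟨Or.inl ?_, ?_⟩
      · rw [primitiveWalkBinomialsDelete_eq]
        exact ⟨a, b, rfl, h, fun i hi => ha i (hi.imp_right Or.inl),
          fun i hi => hb i (hi.imp_right Or.inl)⟩
      · rw [degreeOf_eq_zero_iff_freeOf]
        refine freeOf_monomial_sub ?_ ?_
        · rintro i rfl; exact ha i (Or.inr (Or.inr rfl))
        · rintro i rfl; exact hb i (Or.inr (Or.inr rfl))
    · obtain ⟨a, l, b, rfl, h, hlt, hl0, hl, hF, hE⟩ := mem_monomialGenerators_iff.1 hp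
      refine ⟨Or.inr (mem_monomialGenerators_iff.2
        ⟨a, l, b, rfl, h, hlt, hl0, hl, fun i hi => hF i (Or.inl hi), hE⟩), ?_⟩
      have := hF k (Or.inr rfl)
      rw [Finsupp.add_apply] at this
      rw [degreeOf_monomial_one]
      omega

/-- For a new monomial generator `m` from `mℓ - p` there are two cases. If `ℓ` is a power of the
variable `k`, then `mℓ` avoids all earlier variables; by lex so does `p`, and `m` is the coefficient
of a binomial generator. Otherwise the `k`-part of `ℓ` is moved into `m`, which gives an old
monomial generator. -/
theorem naturalGenerators_subset_initialFormCoeff [CharZero K] :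
    naturalGenerators K G e (E ∪ {k}) F ⊆
      initialFormCoeff k '' naturalGenerators K G e E F := by
  have hEk : ∀ i ∈ E, i < k := fun i hi => hEF.le (Or.inl hi)
  rintro p (hp | hp)
  · rw [primitiveWalkBinomialsDelete_eq] at hp
    obtain ⟨a, b, rfl, h, ha, hb⟩ := hp
    refine ⟨_, Or.inl ?_, initialFormCoeff_eq_self_of_degreeOf_eq_zero ?_⟩
    · rw [primitiveWalkBinomialsDelete_eq]
      exact ⟨a, b, rfl, h, fun i hi => ha i (hi.imp_left Or.inl),
        fun i hi => hb i (hi.imp_left Or.inl)⟩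
    · rw [degreeOf_eq_zero_iff_freeOf]
      refine freeOf_monomial_sub ?_ ?_
      · rintro i rfl; exact ha i (Or.inl (Or.inr rfl))
      · rintro i rfl; exact hb i (Or.inl (Or.inr rfl))
  · obtain ⟨a, l, b, rfl, h, hlt, hl0, hl, hF, hE⟩ := mem_monomialGenerators_iff.1 hp
    have hak : a k = 0 := hE k (Or.inr rfl)
    by_cases hl' : l.erase k = 0
    · have hlk : l = Finsupp.single k (l k) := by
        rw [← add_zero (Finsupp.single k (l k)), ← hl', Finsupp.single_add_erase]
      have hlk0 : l k ≠ 0 := fun h0 => hl0 (by rw [hlk, h0, Finsupp.single_zero])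
      have hfree : ∀ i < k, (a + l) i = 0 := by
        intro i hi
        obtain hi' | hi' : i ∈ E ∪ F := hEF.ge hi
        · rw [Finsupp.add_apply, hE i (Or.inl hi'), hlk, Finsupp.single_eq_of_ne hi.ne, add_zero]
        · exact hF i hi'
      have hbfree := apply_eq_zero_of_lex_lt hlt hfree
      have hlkpos : (a + l) k = l k := by rw [Finsupp.add_apply, hak, zero_add]
      have hbk : b k = 0 := (h.eq_zero_or_eq_zero k).resolve_left (by rwa [hlkpos])
      refine ⟨monomial (a + l) 1 - monomial b 1, Or.inl ?_, ?_⟩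
      · rw [primitiveWalkBinomialsDelete_eq, hEF]
        exact ⟨a + l, b, rfl, h, hfree, hbfree⟩
      · rw [initialFormCoeff_monomial_sub (by omega), Finsupp.erase_add, hl', add_zero,
          Finsupp.erase_of_notMem_support (by simpa using hak)]
    · have hsum : a + Finsupp.single k (l k) + l.erase k = a + l := by
        rw [add_assoc, Finsupp.single_add_erase]
      refine ⟨monomial (a + Finsupp.single k (l k)) 1, Or.inr ?_, ?_⟩
      · refine mem_monomialGenerators_iff.2 ⟨_, l.erase k, b, rfl, by rwa [hsum], by rwa [hsum],
          hl', fun i hi => ?_, fun i hi => by rw [hsum]; exact hF i hi, fun i hi => ?_⟩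
        · by_cases hik : i = k
          · rw [hik, Finsupp.erase_same]
          · rw [Finsupp.erase_ne hik]
            exact hl i (not_or.2 ⟨hi, hik⟩)
        · rw [Finsupp.add_apply, hE i (Or.inl hi), Finsupp.single_eq_of_ne (hEk i hi).ne, add_zero]
      · rw [initialFormCoeff_monomial, Finsupp.erase_add, Finsupp.erase_single, add_zero,
          Finsupp.erase_of_notMem_support (by simpa using hak)]

theorem monomial_erase_mem_monomialGenerators [CharZero K] {a b : Fin n →₀ ℕ}
    (h : IsMinimalPair (vertexDegree G e) a b) (ha : ∀ i ∈ E ∪ F, a i = 0)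
    (hb : ∀ i ∈ E ∪ F, b i = 0) (hk : b k < a k) :
    monomial (a.erase k) (1 : K) ∈ monomialGenerators K G e (E ∪ {k}) F := by
  have hsum : a.erase k + Finsupp.single k (a k) = a := Finsupp.erase_add_single k a
  refine mem_monomialGenerators_iff.2 ⟨_, Finsupp.single k (a k), b, rfl, by rwa [hsum], ?_, ?_,
    fun i hi => ?_, fun i hi => ?_, fun i hi => ?_⟩
  · rw [hsum, lex_lt_iff_exists]
    refine ⟨k, fun j hj => ?_, hk⟩
    have hj' : j ∈ E ∪ F := hEF.ge hj
    rw [ha j hj', hb j hj']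
  · rw [Ne, Finsupp.single_eq_zero]; omega
  · exact Finsupp.single_eq_of_ne fun hik => hi (Or.inr hik)
  · rw [hsum]; exact ha i (Or.inr hi)
  · by_cases hik : i = k
    · rw [hik, Finsupp.erase_same]
    · rw [Finsupp.erase_ne hik]
      exact ha i (Or.inl (hi.resolve_right hik))

/-- In a binomial generator at most one monomial involves `k`; the side on which it occurs decides
the sign. In a monomial generator the `k`-part of `m` moves into `ℓ`. -/
theorem initialFormCoeff_mem_naturalGenerators [CharZero K] :
    ∀ q ∈ initialFormCoeff k '' naturalGenerators K G e E F,
      ∃ p ∈ naturalGenerators K G e (E ∪ {k}) F, q = p ∨ q = -p := by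
  rintro _ ⟨p, hp | hp, rfl⟩
  · rw [primitiveWalkBinomialsDelete_eq] at hp
    obtain ⟨a, b, rfl, h, ha, hb⟩ := hp
    obtain hk | hk | hk := lt_trichotomy (a k) (b k)
    · refine ⟨_, Or.inr (monomial_erase_mem_monomialGenerators hEF h.symm hb ha hk), Or.inr ?_⟩
      rw [← neg_sub, initialFormCoeff_neg, initialFormCoeff_monomial_sub hk]
    · have hak : a k = 0 := by have := h.eq_zero_or_eq_zero k; omega
      have hbk : b k = 0 := by omega
      have hfree : ∀ c : Fin n →₀ ℕ, (∀ i ∈ E ∪ F, c i = 0) → c k = 0 →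
          ∀ i ∈ E ∪ {k} ∪ F, c i = 0 := by
        rintro c hc hck i ((hi | rfl) | hi)
        exacts [hc i (Or.inl hi), hck, hc i (Or.inr hi)]
      refine ⟨monomial a 1 - monomial b 1, Or.inl ?_, Or.inl ?_⟩
      · rw [primitiveWalkBinomialsDelete_eq]
        exact ⟨a, b, rfl, h, hfree a ha hak, hfree b hb hbk⟩
      · refine initialFormCoeff_eq_self_of_degreeOf_eq_zero ?_
        rw [degreeOf_eq_zero_iff_freeOf]
        refine freeOf_monomial_sub ?_ ?_
        · rintro i rfl; exact hak
        · rintro i rfl; exact hbk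
    · refine ⟨_, Or.inr (monomial_erase_mem_monomialGenerators hEF h ha hb hk), Or.inl ?_⟩
      rw [initialFormCoeff_monomial_sub hk]
  · obtain ⟨a, l, b, rfl, h, hlt, hl0, hl, hF, hE⟩ := mem_monomialGenerators_iff.1 hp
    have hsum : a.erase k + (Finsupp.single k (a k) + l) = a + l := by
      rw [← add_assoc, Finsupp.erase_add_single]
    refine ⟨monomial (a.erase k) 1, Or.inr (mem_monomialGenerators_iff.2
      ⟨_, Finsupp.single k (a k) + l, b, rfl, by rwa [hsum], by rwa [hsum], ?_, fun i hi => ?_,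
        by rwa [hsum], fun i hi => ?_⟩), Or.inl (initialFormCoeff_monomial k a)⟩
    · exact fun h0 => hl0 (add_eq_zero.1 h0).2
    · rw [Finsupp.add_apply, hl i fun h => hi (Or.inl h),
        Finsupp.single_eq_of_ne fun h => hi (Or.inr h)]
    · by_cases hik : i = k
      · rw [hik, Finsupp.erase_same]
      · rw [Finsupp.erase_ne hik]
        exact hE i (hi.resolve_right hik)

end NaturalGenerators

/-! ### The induction on the treated labels. -/

section Main

variable {K V : Type*} [Field K] [CharZero K] {n : ℕ} (G : SimpleGraph V)
  (e : Fin n ≃ G.edgeSet)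

/-- The natural generators lead `I^G_{E,F}` and the leading exponents are square-free. -/
def NaturalGeneratorsLead (K : Type*) [Field K] {V : Type*} {n : ℕ} (G : SimpleGraph V)
    (e : Fin n ≃ G.edgeSet) (m : MonomialOrder (Fin n)) (E F : Set (Fin n)) : Prop :=
  LeadsIdeal m (naturalGenerators K G e E F) (idealEF K G e E F) ∧
    HasSquarefreeLeads m (idealEF K G e E F)

variable {G e}

theorem NaturalGeneratorsLead.of_agreeOff {m m' : MonomialOrder (Fin n)} {S E F : Set (Fin n)}
    (hS : S ⊆ E ∪ F) (hm : AgreeOff S m m') (h : NaturalGeneratorsLead K G e m E F) :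
    NaturalGeneratorsLead K G e m' E F := by
  have hB : ∀ p ∈ naturalGenerators K G e E F, FreeOf S p :=
    fun p hp a ha i hi => freeOf_naturalGenerators hp a ha i (hS hi)
  exact ⟨h.1.of_agreeOff hm hB, h.2.of_agreeOff hm hB h.1⟩

variable {k : Fin n} {E F : Set (Fin n)}

theorem NaturalGeneratorsLead.idealC_eq (hEF : E ∪ F = {i | i < k})
    (h : NaturalGeneratorsLead K G e (lexFirst k) E F) :
    idealC k (idealEF K G e E F : Set (MvPolynomial (Fin n) K)) = idealEF K G e (E ∪ {k}) F ∧
      NaturalGeneratorsLead K G e (lexFirst k) (E ∪ {k}) F := by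
  have hy := lexFirst_lt_of_apply_lt k
  have h1 := (h.1.idealC_leads hy).of_eq_or_eq_neg (naturalGenerators_subset_initialFormCoeff hEF)
    (initialFormCoeff_mem_naturalGenerators hEF)
  have h2 := h1.span_eq.symm.trans (idealEF_eq_span G e (E ∪ {k}) F)
  exact ⟨h2, h2 ▸ h1, h2 ▸ h.2.idealC hy⟩

theorem NaturalGeneratorsLead.idealN_eq (hEF : E ∪ F = {i | i < k})
    (h : NaturalGeneratorsLead K G e (lexFirst k) E F) :
    idealN k (idealEF K G e E F : Set (MvPolynomial (Fin n) K)) = idealEF K G e E (F ∪ {k}) ∧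
      NaturalGeneratorsLead K G e (lexFirst k) E (F ∪ {k}) := by
  have hy := lexFirst_lt_of_apply_lt k
  have h1 := h.1.idealN_leads hy
  rw [naturalGenerators_filter_eq hEF] at h1
  have h2 := h1.span_eq.symm.trans (idealEF_eq_span G e E (F ∪ {k}))
  exact ⟨h2, h2 ▸ h1, h2 ▸ h.2.idealN hy⟩

theorem NaturalGeneratorsLead.lexFirst (hEF : E ∪ F = {i | i < k})
    (h : NaturalGeneratorsLead K G e MonomialOrder.lex E F) :
    NaturalGeneratorsLead K G e (lexFirst k) E F :=
  h.of_agreeOff hEF.ge (agreeOff_lex_lexFirst k)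

theorem naturalGeneratorsLead_empty
    (hG : IsSquarefreeMonomialIdeal (initialIdeal MonomialOrder.lex (toricIdeal K G e))) :
    NaturalGeneratorsLead K G e MonomialOrder.lex ∅ ∅ := by
  have hB : naturalGenerators K G e ∅ ∅ = primitiveWalkBinomials K G e := by
    have h1 : monomialGenerators K G e ∅ ∅ = ∅ := by
      refine Set.eq_empty_of_forall_notMem fun q hq => ?_
      obtain ⟨a, l, b, -, -, -, hl0, hl, -⟩ := mem_monomialGenerators_iff.1 hq
      exact hl0 (Finsupp.ext fun i => hl i (Set.notMem_empty i))
    rw [naturalGenerators, h1, primitiveWalkBinomialsDelete_eq, primitiveWalkBinomials_eq]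
    simp
  have hL := leadsIdeal_primitiveWalkBinomials G e K MonomialOrder.lex
  have hI : idealEF K G e ∅ ∅ = toricIdeal K G e := by
    rw [← idealEF_eq_span, hB, hL.span_eq]
  rw [NaturalGeneratorsLead, hI, hB]
  exact ⟨hL, (isSquarefreeMonomialIdeal_initialIdeal_iff _ _).1 hG⟩

/-- Remove the last label `k` from `E` or `F`, pass to `lexFirst k`, take `C` if `k` was in `E` and
`N` if it was in `F`, and return to lex. -/
theorem naturalGeneratorsLead_of_union_eq
    (hG : IsSquarefreeMonomialIdeal (initialIdeal MonomialOrder.lex (toricIdeal K G e)))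
    (j : ℕ) (hj : j ≤ n) (E F : Set (Fin n)) (hdisj : Disjoint E F)
    (hEF : E ∪ F = {i : Fin n | (i : ℕ) < j}) :
    NaturalGeneratorsLead K G e MonomialOrder.lex E F := by
  induction j generalizing E F with
  | zero =>
    have : E ∪ F = ∅ := by simpa using hEF
    obtain ⟨rfl, rfl⟩ := Set.union_empty_iff.1 this
    exact naturalGeneratorsLead_empty hG
  | succ j ih =>
    set k : Fin n := ⟨j, hj⟩ with hk
    have hmem : ∀ i, i ∈ E ∪ F ↔ i < k ∨ i = k := by
      intro i
      rw [hEF, Set.mem_ofPred_eq, ← le_iff_lt_or_eq, hk, Fin.le_def, Nat.lt_succ_iff]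
    have hrem : (E \ {k}) ∪ (F \ {k}) = {i | i < k} := by
      rw [← Set.union_sdiff_distrib]
      ext i
      rw [Set.mem_sdiff, hmem, Set.mem_ofPred_eq, Set.mem_singleton_iff]
      exact ⟨fun h => h.1.resolve_right h.2, fun h => ⟨Or.inl h, h.ne⟩⟩
    have hfirst := (ih (Nat.le_of_succ_le hj) (E \ {k}) (F \ {k})
      (hdisj.mono Set.sdiff_subset Set.sdiff_subset) hrem).lexFirst hrem
    have hsub : {i | i < k} ⊆ E ∪ F := fun i hi => (hmem i).2 (Or.inl hi)
    obtain hkE | hkF : k ∈ E ∪ F := (hmem k).2 (Or.inr rfl)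
    · have hkF : k ∉ F := fun h => Set.disjoint_left.1 hdisj hkE h
      have := (hfirst.idealC_eq hrem).2
      rw [Set.sdiff_singleton_eq_self hkF, Set.sdiff_union_of_subset
        (Set.singleton_subset_iff.2 hkE)] at this
      exact this.of_agreeOff hsub (agreeOff_lex_lexFirst k).symm
    · have hkE : k ∉ E := fun h => Set.disjoint_left.1 hdisj h hkF
      have := (hfirst.idealN_eq hrem).2
      rw [Set.sdiff_singleton_eq_self hkE, Set.sdiff_union_of_subset
        (Set.singleton_subset_iff.2 hkF)] at this
      exact this.of_agreeOff hsub (agreeOff_lex_lexFirst k).symm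

end Main

end

/-- The edges of `G` are `e 0, …, e (n-1)`, ordered so that `e 0` is the largest variable of the
lexicographic order; `k` is the label of the edge to be treated next and `E ∪ F` is the set of all
labels before `k`. -/
theorem mainTheorem10 {K : Type*} [Field K] [IsAlgClosed K] [CharZero K]
    {V : Type*} [Finite V] {n : ℕ} (G : SimpleGraph V) (e : Fin n ≃ G.edgeSet)
    (hG : IsSquarefreeMonomialIdeal (initialIdeal MonomialOrder.lex (toricIdeal K G e)))
    (k : Fin n) (E F : Set (Fin n)) (hdisj : Disjoint E F) (hEF : E ∪ F = {i | i < k}) :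
    -- the natural generators form a Groebner basis, and the initial ideal is square-free
    (Ideal.span (naturalGenerators K G e E F) = idealEF K G e E F ∧
      IsGroebnerBasisOf MonomialOrder.lex (naturalGenerators K G e E F) (idealEF K G e E F) ∧
      IsSquarefreeMonomialIdeal (initialIdeal MonomialOrder.lex (idealEF K G e E F))) ∧
    -- the ideal is radical
    (idealEF K G e E F).IsRadical ∧
    -- the variable labelled `k` defines a geometric vertex decomposition
    HasGeometricVertexDecomposition k (idealEF K G e E F) ∧
    -- the ideals `C` and `N`, for every compatible order and every Groebner basis
    (∀ (m : MonomialOrder.{0, 0} (Fin n)) (B : Set (MvPolynomial (Fin n) K)),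
      IsCompatibleOrder K m k → IsGroebnerBasisOf m B (idealEF K G e E F) →
        idealC k B = idealEF K G e (E ∪ {k}) F ∧ idealN k B = idealEF K G e E (F ∪ {k})) ∧
    initialFormIdeal k (idealEF K G e E F) =
      idealEF K G e (E ∪ {k}) F ⊓
        (idealEF K G e E (F ∪ {k}) ⊔ Ideal.span {MvPolynomial.X k}) := by
  have h := naturalGeneratorsLead_of_union_eq hG k k.2.le E F hdisj hEF
  have hfirst := h.lexFirst hEF
  have hy := lexFirst_lt_of_apply_lt k
  have hfin := finite_naturalGenerators (K := K) (G := G) (e := e) E F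
  have hC := (hfirst.idealC_eq hEF).1
  have hN := (hfirst.idealN_eq hEF).1
  have hinf := hfirst.2.initialFormIdeal_eq_inf hy
  refine ⟨⟨idealEF_eq_span G e E F, (isGroebnerBasisOf_iff _ _ _).2 ⟨hfin, h.1⟩,
    (isSquarefreeMonomialIdeal_initialIdeal_iff _ _).2 h.2⟩, h.2.isRadical, ?_, ?_, ?_⟩
  · refine ⟨lexFirst k, naturalGenerators K G e E F, (isCompatibleOrder_iff _ _).2 hy,
      (isGroebnerBasisOf_iff _ _ _).2 ⟨hfin, hfirst.1⟩, ?_⟩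
    rw [hfirst.1.idealC_eq hy, hfirst.1.idealN_eq hy]
    exact hinf
  · intro m B hm hB
    have hm' := (isCompatibleOrder_iff m k).1 hm
    have hB' := ((isGroebnerBasisOf_iff m B _).1 hB).2
    -- Both ideals are compared with those computed from all of `I` in place of a basis, a choice
    -- that involves no order.
    exact ⟨(hB'.idealC_eq hm').trans hC, (hB'.idealN_eq hm').trans hN⟩
  · rw [hinf, hC, hN]
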